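/- **Theorem.** Let $Y$ be a Banach space, let $A,B$ be bounded linear operators on $Y$ (which need not commute), and let $1<\alpha\le 2$, $0<\beta\le 1$, $T>0$, $J=[0,T]$, $g\in C(J,Y)$ and $\eta,\hat\eta\in Y$. No exponential boundedness is assumed. *Notation.* Let $Q_{k,0}=A^k$ and $Q_{k,m}=\sum_{l=0}^{k}A^{k-l}B\,Q_{l,m-1}$ for $k\ge0$, $m\ge 1$ (so that $Q_{0,m}=B^m$), and $$\mathscr E_{a,b,c}(t)=\sum_{k=0}^\infty\sum_{m=0}^\infty Q_{k,m}\,\frac{t^{ka+mb}}{\Gamma(ka+mb+c)} .$$ For $\gamma>0$ let $(I^\gamma f)(t)=\frac1{\Gamma(\gamma)}\int_0^t(t-s)^{\gamma-1}f(s)\,ds$ (Bochner integral), and $I^0f=f$. For $n-1<\nu\le n$, $n\in\mathbb N$, the Caputo derivative of order $\nu$ is $$({}^{C}\!D^{\nu}x)(t)=\frac{d^n}{dt^n}\,I^{n-\nu}\Bigl(x-\sum_{k=0}^{n-1}\frac{(\cdot)^k}{k!}x^{(k)}(0)\Bigr)(t),\qquad 0<t\le T,$$ and if $x\in C^n(J,Y)$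 it also has the integral form $({}^{C}\!D^{\nu}x)(t)=(I^{n-\nu}x^{(n)})(t)$. Derivatives at the endpoints of intervals are one-sided. Consider the Cauchy problem $$({}^{C}\!D^{\alpha}x)(t)-A\,({}^{C}\!D^{\beta}x)(t)=Bx(t)+g(t)\quad(0<t\le T),\qquad x(0)=\eta,\quad x'(0)=\hat\eta. \tag{1}$$ A *mild solution* of (1) is a function $x\in C^1(J,Y)$ for which the Caputo derivatives ${}^{C}\!D^{\alpha}x$ and ${}^{C}\!D^{\beta}x$, in the first form, exist and are continuous on $(0,T]$ (that is, for $\nu=\alpha,\beta$ the function under $d^n/dt^n$ is of class $C^n$ on $(0,T]$) and (1) holds. Define $$x_*(t)=\bigl(I+t^{\alpha}\mathscr E_{\alpha-\beta,\alpha,\alpha+1}(t)B\bigr)\eta+t\,\mathscr E_{\alpha-\beta,\alpha,2}(t)\,\hat\eta+\int_0^t(t-s)^{\alpha-1}\mathscr E_{\alpha-\beta,\alpha,\alpha}(t-s)\,g(s)\,ds .$$ *Claim.* The three double series $\mathscr E_{\alpha-\beta,\alpha,c}(t)$, $c\in\{\alpha+1,2,\alpha\}$, converge absolutely in operator norm for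 every $t\ge0$; the integral converges for every $t\in J$; $x_*$ is a mild solution of (1); every mild solution $x$ of (1) satisfies $x=x_*$ on $J$; and every $x\in C^2(J,Y)$ that satisfies (1) with the Caputo derivatives in integral form satisfies $x=x_*$ on $J$. -/

import Mathlib

open Set MeasureTheory

noncomputable section

namespace FracEvol

variable {Y : Type*} [NormedAddCommGroup Y] [NormedSpace ℝ Y]

/-- The operators `Q_{k,m}^{A,B}`: `Q_{k,0} = A^k` and
`Q_{k,m} = ∑_{l=0}^{k} A^{k-l} B Q_{l,m-1}` for `m ≥ 1`. For `k = 0` this gives `Q_{0,m} = B^m`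
(see `Q_zero_left`). -/
def Q (A B : Y →L[ℝ] Y) : ℕ → ℕ → (Y →L[ℝ] Y)
  | k, 0 => A ^ k
  | k, m + 1 => ∑ l ∈ Finset.range (k + 1), A ^ (k - l) * B * Q A B l m

theorem Q_zero_left (A B : Y →L[ℝ] Y) (m : ℕ) : Q A B 0 m = B ^ m := by
  induction m with
  | zero => simp [Q]
  | succ m ih => simp [Q, ih, pow_succ']

/-- The `(k, m)` term of the Mittag-Leffler type series with parameters `a, b, c`:
`Q_{k,m}^{A,B} t^{k a + m b} / Γ(k a + m b + c)`. -/
def mlTerm (a b c : ℝ) (A B : Y →L[ℝ] Y) (t : ℝ) (k m : ℕ) : Y →L[ℝ] Y :=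
  (t ^ ((k : ℝ) * a + (m : ℝ) * b) / Real.Gamma ((k : ℝ) * a + (m : ℝ) * b + c)) • Q A B k m

/-- The Mittag-Leffler type function `ℰ_{a,b,c}^{A,B}(t)`, a double series in the Banach space of
bounded operators. -/
def mittagLeffler (a b c : ℝ) (A B : Y →L[ℝ] Y) (t : ℝ) : Y →L[ℝ] Y :=
  ∑' k : ℕ, ∑' m : ℕ, mlTerm a b c A B t k m

/-- The Riemann-Liouville fractional integral `I^γ_{0+} f` of order `γ ≥ 0`, with `I^0 f = f`. -/
def fracInt (γ : ℝ) (f : ℝ → Y) (t : ℝ) : Y :=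
  if γ = 0 then f t
  else (Real.Gamma γ)⁻¹ • ∫ s in (0 : ℝ)..t, (t - s) ^ (γ - 1) • f s

/-- The Taylor polynomial at `0`, of degree less than `n`, of a function `x` on `[0, T]`. -/
def taylorZero (n : ℕ) (T : ℝ) (x : ℝ → Y) (t : ℝ) : Y :=
  ∑ k ∈ Finset.range n, (t ^ k / (k.factorial : ℝ)) • iteratedDerivWithin k x (Icc 0 T) 0

/-- `I^{n-α}_{0+} (x - ∑_{k<n} t^k x^{(k)}(0) / k!)` with `n = ⌈α⌉`, that is `n - 1 < α ≤ n`: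
the function whose `n`-th derivative is the Caputo derivative of `x`. -/
def caputoPrimitive (α T : ℝ) (x : ℝ → Y) : ℝ → Y :=
  fracInt ((⌈α⌉₊ : ℝ) - α) (fun t => x t - taylorZero ⌈α⌉₊ T x t)

/-- The Caputo derivative of order `α` exists, and is continuous, on `(0, T]`. -/
def CaputoDifferentiable (α T : ℝ) (x : ℝ → Y) : Prop :=
  ContDiffOn ℝ ⌈α⌉₊ (caputoPrimitive α T x) (Ioc 0 T)

/-- The Caputo derivative of `x : [0, T] → Y`, as the Riemann-Liouville derivative of
`x - ∑_{k<n} t^k x^{(k)}(0) / k!`; one-sided derivatives at `t = T`. -/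
def caputo (α T : ℝ) (x : ℝ → Y) (t : ℝ) : Y :=
  iteratedDerivWithin ⌈α⌉₊ (caputoPrimitive α T x) (Ioc 0 T) t

/-- The integral form `I^{n-α}_{0+} x^{(n)}`, `n = ⌈α⌉`, of the Caputo derivative, for a function
which is `n` times continuously differentiable on `[0, T]`. -/
def caputoIntegral (α T : ℝ) (x : ℝ → Y) (t : ℝ) : Y :=
  fracInt ((⌈α⌉₊ : ℝ) - α) (iteratedDerivWithin ⌈α⌉₊ x (Icc 0 T)) t

/-- `x` is a (mild) solution on `[0, T]` of
`D^α x - A D^β x = B x + g` for `t > 0`, `x(0) = η`, `x'(0) = η'`: it is continuously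
differentiable, and the Caputo derivatives are taken as Riemann-Liouville derivatives of
`x` minus its Taylor polynomial, so that no second derivative of `x` is needed. -/
structure IsMildSolution (α β T : ℝ) (A B : Y →L[ℝ] Y) (g : ℝ → Y) (η η' : Y)
    (x : ℝ → Y) : Prop where
  contDiffOn : ContDiffOn ℝ 1 x (Icc 0 T)
  init_zero : x 0 = η
  init_one : derivWithin x (Icc 0 T) 0 = η'
  caputo_alpha : CaputoDifferentiable α T x
  caputo_beta : CaputoDifferentiable β T x
  equation : ∀ t ∈ Ioc 0 T, caputo α T x t - A (caputo β T x t) = B (x t) + g t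

/-- `x` is a twice continuously differentiable solution on `[0, T]` of the same Cauchy problem,
with the Caputo derivatives in integral form. -/
structure IsClassicalSolution (α β T : ℝ) (A B : Y →L[ℝ] Y) (g : ℝ → Y) (η η' : Y)
    (x : ℝ → Y) : Prop where
  contDiffOn : ContDiffOn ℝ 2 x (Icc 0 T)
  init_zero : x 0 = η
  init_one : derivWithin x (Icc 0 T) 0 = η'
  equation : ∀ t ∈ Ioc 0 T,
    caputoIntegral α T x t - A (caputoIntegral β T x t) = B (x t) + g t

/-- The explicit formula
`(I + t^α ℰ_{α-β,α,α+1}(t) B) η + t ℰ_{α-β,α,2}(t) η'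
  + ∫_0^t (t-s)^{α-1} ℰ_{α-β,α,α}(t-s) g(s) ds`. -/
def solutionFormula (α β : ℝ) (A B : Y →L[ℝ] Y) (g : ℝ → Y) (η η' : Y) (t : ℝ) : Y :=
  (1 + t ^ α • (mittagLeffler (α - β) α (α + 1) A B t * B)) η
    + t • mittagLeffler (α - β) α 2 A B t η'
    + ∫ s in (0 : ℝ)..t, (t - s) ^ (α - 1) • mittagLeffler (α - β) α α A B (t - s) (g s)

end FracEvol

end

noncomputable section

namespace FracEvol

variable {Y : Type*} [NormedAddCommGroup Y] [NormedSpace ℝ Y]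

/-! With `z = x - η`, integrating (1) turns it into the Volterra equation `z = F + A I^{α-β} z + B
I^α z`, where `F(t) = t η' + I^α (Bη + g)(t)`, and for `C^1` functions the step can be reversed.
Bounded operators commute with fractional integrals and `I^a I^b = I^{a+b}`. The Neumann series of
`A I^a + B I^b` therefore collects, for each `(k, m)`, all words with `k` letters `A` and `m`
letters `B`; their sum is `Q_{k,m}`, and it multiplies `I^{ka+mb}`. This series is `resolvent`, and
`resolvent_eq` is the recursion for `Q` read termwise.

Everything analytic rests on `norm_fracInt_le`: in the norm weighted by `e^{-lt}`, `I^γ` has norm at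
most `l^{-γ}`. Since `‖Q_{k,m}‖ ≤ (2‖A‖)^k (2‖B‖)^m`, a large `l` dominates the series by a product
of geometric series and makes the Volterra operator a contraction, which gives uniqueness
(`eqOn_of_volterra`). On a compact interval the weight costs nothing, so no growth condition on `g`
is needed.

Inserting `F` into the resolvent term by term yields the explicit formula (`solutionFormula_eq`). It
is `C^1` because the resolvent of `F` is `I^1` of the resolvent of `F'`
(`resolvent_eq_fracInt_one`). -/

/-! ### Elementary properties of fractional integrals -/

theorem fracInt_zero (f : ℝ → Y) : fracInt 0 f = f := by
  funext t
  simp [fracInt]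

theorem fracInt_of_pos {γ : ℝ} (hγ : 0 < γ) (f : ℝ → Y) (t : ℝ) :
    fracInt γ f t = (Real.Gamma γ)⁻¹ • ∫ s in (0 : ℝ)..t, (t - s) ^ (γ - 1) • f s := by
  simp [fracInt, hγ.ne']

theorem fracInt_one (f : ℝ → Y) (t : ℝ) : fracInt 1 f t = ∫ s in (0 : ℝ)..t, f s := by
  simp [fracInt_of_pos]

theorem fracInt_apply_zero {γ : ℝ} (hγ : 0 < γ) (f : ℝ → Y) : fracInt γ f 0 = 0 := by
  simp [fracInt_of_pos hγ]

theorem fracInt_congr {γ t : ℝ} {f g : ℝ → Y} (ht : 0 ≤ t) (h : EqOn f g (Icc 0 t)) :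
    fracInt γ f t = fracInt γ g t := by
  unfold fracInt
  split_ifs
  · exact h ⟨ht, le_rfl⟩
  · congr 1
    refine intervalIntegral.integral_congr fun s hs => ?_
    rw [uIcc_of_le ht] at hs
    simp only [h hs]

theorem fracInt_eqOn {γ T : ℝ} {f g : ℝ → Y} (h : EqOn f g (Icc 0 T)) :
    EqOn (fracInt γ f) (fracInt γ g) (Icc 0 T) :=
  fun _ ht => fracInt_congr ht.1 (h.mono (Icc_subset_Icc_right ht.2))

theorem intervalIntegrable_sub_rpow {γ : ℝ} (hγ : 0 < γ) (t : ℝ) :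
    IntervalIntegrable (fun s => (t - s) ^ (γ - 1)) volume 0 t := by
  have := (intervalIntegral.intervalIntegrable_rpow' (a := t) (b := 0)
    (r := γ - 1) (by linarith)).comp_sub_left t
  simpa using this

theorem intervalIntegrable_sub_rpow_smul {γ t : ℝ} {f : ℝ → Y} (hγ : 0 < γ) (ht : 0 ≤ t)
    (hf : ContinuousOn f (Icc 0 t)) :
    IntervalIntegrable (fun s => (t - s) ^ (γ - 1) • f s) volume 0 t :=
  (intervalIntegrable_sub_rpow hγ t).smul_continuousOn (by rwa [uIcc_of_le ht])

theorem fracInt_add {γ t : ℝ} {f g : ℝ → Y} (hγ : 0 ≤ γ) (ht : 0 ≤ t)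
    (hf : ContinuousOn f (Icc 0 t)) (hg : ContinuousOn g (Icc 0 t)) :
    fracInt γ (fun s => f s + g s) t = fracInt γ f t + fracInt γ g t := by
  rcases hγ.eq_or_lt with rfl | hγ
  · simp [fracInt_zero]
  · simp only [fracInt_of_pos hγ, smul_add]
    rw [intervalIntegral.integral_add (intervalIntegrable_sub_rpow_smul hγ ht hf)
      (intervalIntegrable_sub_rpow_smul hγ ht hg), smul_add]

theorem fracInt_sub {γ t : ℝ} {f g : ℝ → Y} (hγ : 0 ≤ γ) (ht : 0 ≤ t)
    (hf : ContinuousOn f (Icc 0 t)) (hg : ContinuousOn g (Icc 0 t)) :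
    fracInt γ (fun s => f s - g s) t = fracInt γ f t - fracInt γ g t := by
  rcases hγ.eq_or_lt with rfl | hγ
  · simp [fracInt_zero]
  · simp only [fracInt_of_pos hγ, smul_sub]
    rw [intervalIntegral.integral_sub (intervalIntegrable_sub_rpow_smul hγ ht hf)
      (intervalIntegrable_sub_rpow_smul hγ ht hg), smul_sub]

theorem fracInt_clm [CompleteSpace Y] {γ t : ℝ} {f : ℝ → Y} (hγ : 0 ≤ γ) (ht : 0 ≤ t)
    (hf : ContinuousOn f (Icc 0 t)) (A : Y →L[ℝ] Y) :
    fracInt γ (fun s => A (f s)) t = A (fracInt γ f t) := by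
  rcases hγ.eq_or_lt with rfl | hγ
  · simp [fracInt_zero]
  · simp only [fracInt_of_pos hγ, map_smul]
    rw [← A.intervalIntegral_comp_comm (intervalIntegrable_sub_rpow_smul hγ ht hf)]
    simp only [map_smul]

theorem fracInt_const [CompleteSpace Y] {γ t : ℝ} (hγ : 0 ≤ γ) (v : Y) :
    fracInt γ (fun _ => v) t = (t ^ γ / Real.Gamma (γ + 1)) • v := by
  rcases hγ.eq_or_lt with rfl | hγ
  · simp [fracInt_zero]
  · rw [fracInt_of_pos hγ, intervalIntegral.integral_smul_const,
      intervalIntegral.integral_comp_sub_left (fun s => s ^ (γ - 1)), sub_self, sub_zero,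
      integral_rpow (Or.inl (by linarith)), smul_smul, Real.Gamma_add_one hγ.ne', sub_add_cancel,
      Real.zero_rpow hγ.ne', sub_zero]
    congr 1
    have := (Real.Gamma_pos_of_pos hγ).ne'
    field_simp

/-- The substitution `s = t u` removes `t` from the limits and from the singular kernel, so that
continuity in `t` follows by dominated convergence. -/
theorem fracInt_eq_integral_unit {γ t : ℝ} (hγ : 0 < γ) (ht : 0 ≤ t) (f : ℝ → Y) :
    fracInt γ f t =
      (t ^ γ / Real.Gamma γ) • ∫ u in (0 : ℝ)..1, (1 - u) ^ (γ - 1) • f (t * u) := by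
  rcases ht.eq_or_lt with rfl | ht
  · simp [fracInt_of_pos hγ, Real.zero_rpow hγ.ne']
  · have h := intervalIntegral.integral_comp_mul_left
      (a := 0) (b := 1) (fun s => (t - s) ^ (γ - 1) • f s) ht.ne'
    rw [mul_zero, mul_one] at h
    have h2 : ∫ u in (0 : ℝ)..1, (t - t * u) ^ (γ - 1) • f (t * u)
        = t ^ (γ - 1) • ∫ u in (0 : ℝ)..1, (1 - u) ^ (γ - 1) • f (t * u) := by
      rw [← intervalIntegral.integral_smul]
      refine intervalIntegral.integral_congr fun u hu => ?_
      rw [uIcc_of_le zero_le_one] at hu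
      simp only [smul_smul]
      rw [← Real.mul_rpow ht.le (by linarith [hu.2])]
      congr 2
      ring
    rw [h2] at h
    have h3 : ∫ s in (0 : ℝ)..t, (t - s) ^ (γ - 1) • f s
        = t ^ γ • ∫ u in (0 : ℝ)..1, (1 - u) ^ (γ - 1) • f (t * u) := by
      have : t ^ γ = t * t ^ (γ - 1) := by
        rw [← Real.rpow_one_add' ht.le (by linarith)]
        congr 1
        ring
      rw [this, mul_smul, h, smul_inv_smul₀ ht.ne']
    rw [fracInt_of_pos hγ, h3, smul_smul]
    congr 1
    ring

theorem continuousOn_fracInt {γ T : ℝ} {f : ℝ → Y} (hγ : 0 ≤ γ) (hf : ContinuousOn f (Icc 0 T)) :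
    ContinuousOn (fracInt γ f) (Icc 0 T) := by
  rcases hγ.eq_or_lt with rfl | hγ
  · rwa [fracInt_zero]
  obtain ⟨M, hM⟩ := isCompact_Icc.exists_bound_of_continuousOn hf
  have hmem : ∀ t ∈ Icc 0 T, ∀ u ∈ Ioc (0 : ℝ) 1, t * u ∈ Icc 0 T := fun t ht u hu =>
    ⟨mul_nonneg ht.1 hu.1.le, (mul_le_of_le_one_right ht.1 hu.2).trans ht.2⟩
  have key : ContinuousOn
      (fun t => ∫ u in (0 : ℝ)..1, (1 - u) ^ (γ - 1) • f (t * u)) (Icc 0 T) := by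
    simp only [intervalIntegral.integral_of_le zero_le_one]
    refine continuousOn_of_dominated (bound := fun u => (1 - u) ^ (γ - 1) * M) ?_ ?_ ?_ ?_
    · intro t ht
      refine AEStronglyMeasurable.smul (Measurable.aestronglyMeasurable (by measurability)) ?_
      refine ContinuousOn.aestronglyMeasurable ?_ measurableSet_Ioc
      exact hf.comp (by fun_prop) (fun u hu => hmem t ht u hu)
    · intro t ht
      refine (ae_restrict_iff' measurableSet_Ioc).2 (.of_forall fun u hu => ?_)
      have : 0 ≤ (1 - u) ^ (γ - 1) := Real.rpow_nonneg (by linarith [hu.2]) _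
      rw [norm_smul, Real.norm_of_nonneg this]
      exact mul_le_mul_of_nonneg_left (hM _ (hmem t ht u hu)) this
    · exact ((intervalIntegrable_iff_integrableOn_Ioc_of_le zero_le_one).1
        (intervalIntegrable_sub_rpow hγ 1)).mul_const M
    · refine (ae_restrict_iff' measurableSet_Ioc).2 (.of_forall fun u hu => ?_)
      refine ContinuousOn.const_smul ?_ _
      exact hf.comp (by fun_prop) (fun t ht => hmem t ht u hu)
  refine ContinuousOn.congr (f := fun t => (t ^ γ / Real.Gamma γ) •
    ∫ u in (0 : ℝ)..1, (1 - u) ^ (γ - 1) • f (t * u)) ?_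
    fun t ht => fracInt_eq_integral_unit hγ ht.1 f
  exact (((Real.continuous_rpow_const hγ.le).div_const _).continuousOn).smul key

/-! ### Exponentially weighted bounds -/

theorem integral_sub_rpow_mul_exp_le {γ l t : ℝ} (hγ : 0 < γ) (hl : 0 < l) (ht : 0 ≤ t) :
    ∫ s in (0 : ℝ)..t, (t - s) ^ (γ - 1) * Real.exp (l * s)
      ≤ Real.Gamma γ * (Real.exp (l * t) * l ^ (-γ)) := by
  have h1 : ∫ s in (0 : ℝ)..t, (t - s) ^ (γ - 1) * Real.exp (l * s)
      = Real.exp (l * t) * ∫ r in (0 : ℝ)..t, r ^ (γ - 1) * Real.exp (-(l * r)) := by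
    rw [← intervalIntegral.integral_const_mul]
    have := intervalIntegral.integral_comp_sub_left (a := 0) (b := t)
      (fun r => Real.exp (l * t) * (r ^ (γ - 1) * Real.exp (-(l * r)))) t
    rw [sub_self, sub_zero] at this
    rw [← this]
    refine intervalIntegral.integral_congr fun s _ => ?_
    rw [mul_left_comm, ← Real.exp_add]
    congr 2
    ring
  have h2 := Real.integral_rpow_mul_exp_neg_mul_Ioi hγ hl
  have hpos : 0 < (1 / l) ^ γ * Real.Gamma γ := by
    have := Real.Gamma_pos_of_pos hγ
    positivity
  -- A non-integrable function has integral `0` by convention, so a nonzero value proves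
  -- integrability.
  have hint : IntegrableOn (fun r => r ^ (γ - 1) * Real.exp (-(l * r))) (Ioi 0) :=
    not_imp_comm.1 integral_undef (by rw [h2]; exact hpos.ne')
  have h3 : ∫ r in (0 : ℝ)..t, r ^ (γ - 1) * Real.exp (-(l * r)) ≤ (1 / l) ^ γ * Real.Gamma γ := by
    rw [← h2, intervalIntegral.integral_of_le ht]
    refine setIntegral_mono_set hint ?_ (LE.le.eventuallyLE Ioc_subset_Ioi_self)
    refine (ae_restrict_iff' measurableSet_Ioi).2 (.of_forall fun r hr => ?_)
    have : (0 : ℝ) < r := hr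
    simp only [Pi.zero_apply]
    positivity
  rw [h1]
  calc _ ≤ Real.exp (l * t) * ((1 / l) ^ γ * Real.Gamma γ) := by gcongr
    _ = _ := by
      rw [one_div, Real.inv_rpow hl.le, Real.rpow_neg hl.le]
      ring

theorem norm_fracInt_le {γ l t M : ℝ} {f : ℝ → Y} (hγ : 0 ≤ γ) (hl : 0 < l) (ht : 0 ≤ t)
    (hM : ∀ s ∈ Icc 0 t, ‖f s‖ ≤ M * Real.exp (l * s)) :
    ‖fracInt γ f t‖ ≤ M * Real.exp (l * t) * l ^ (-γ) := by
  rcases hγ.eq_or_lt with rfl | hγ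
  · simpa [fracInt_zero] using hM t ⟨ht, le_rfl⟩
  have hG := Real.Gamma_pos_of_pos hγ
  have hM0 : 0 ≤ M := by
    have := (norm_nonneg _).trans (hM 0 ⟨le_rfl, ht⟩)
    simpa using this
  have h1 : ‖∫ s in (0 : ℝ)..t, (t - s) ^ (γ - 1) • f s‖
      ≤ ∫ s in (0 : ℝ)..t, M * ((t - s) ^ (γ - 1) * Real.exp (l * s)) := by
    refine intervalIntegral.norm_integral_le_of_norm_le ht (.of_forall fun s hs => ?_) ?_
    · have : 0 ≤ (t - s) ^ (γ - 1) := Real.rpow_nonneg (by linarith [hs.2]) _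
      rw [norm_smul, Real.norm_of_nonneg this]
      calc _ ≤ (t - s) ^ (γ - 1) * (M * Real.exp (l * s)) := by
            gcongr
            exact hM s ⟨hs.1.le, hs.2⟩
        _ = _ := by ring
    · exact ((intervalIntegrable_sub_rpow hγ t).mul_continuousOn (by fun_prop)).const_mul M
  rw [intervalIntegral.integral_const_mul] at h1
  rw [fracInt_of_pos hγ, norm_smul, norm_inv, Real.norm_of_nonneg hG.le]
  calc _ ≤ (Real.Gamma γ)⁻¹ * (M * (Real.Gamma γ * (Real.exp (l * t) * l ^ (-γ)))) := by
        gcongr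
        exact h1.trans (by gcongr; exact integral_sub_rpow_mul_exp_le hγ hl ht)
    _ = _ := by field_simp

/-! ### The Beta integral, the fundamental theorem of calculus and the semigroup law -/

theorem integral_sub_rpow_mul_sub_rpow {a b r t : ℝ} (ha : 0 < a) (hb : 0 < b) (hrt : r < t) :
    ∫ s in r..t, (t - s) ^ (a - 1) * (s - r) ^ (b - 1)
      = (t - r) ^ (a + b - 1) * (Real.Gamma a * Real.Gamma b / Real.Gamma (a + b)) := by
  have hc : 0 < t - r := sub_pos.2 hrt
  have h1 := intervalIntegral.integral_comp_sub_right (a := r) (b := t)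
    (fun x => x ^ (b - 1) * (t - r - x) ^ (a - 1)) r
  rw [sub_self] at h1
  have h2 : ∫ s in r..t, (t - s) ^ (a - 1) * (s - r) ^ (b - 1)
      = ∫ x in (0 : ℝ)..(t - r), x ^ (b - 1) * (t - r - x) ^ (a - 1) := by
    rw [← h1]
    refine intervalIntegral.integral_congr fun s _ => ?_
    simp only [mul_comm, sub_sub_sub_cancel_right]
  rw [h2]
  apply Complex.ofReal_injective
  rw [← intervalIntegral.integral_ofReal]
  have h3 := Complex.betaIntegral_scaled b a hc
  rw [Complex.betaIntegral_eq_Gamma_mul_div _ _ (by simpa) (by simpa)] at h3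
  calc _ = ∫ x in (0 : ℝ)..(t - r), (x : ℂ) ^ ((b : ℂ) - 1) * (((t - r : ℝ) : ℂ) - x) ^ ((a : ℂ) - 1) := by
        refine intervalIntegral.integral_congr fun x hx => ?_
        rw [uIcc_of_le hc.le] at hx
        rw [Complex.ofReal_mul, Complex.ofReal_cpow hx.1, Complex.ofReal_cpow (by linarith [hx.2])]
        push_cast
        rfl
    _ = _ := by
        rw [h3, Complex.ofReal_mul, Complex.ofReal_cpow hc.le]
        simp only [Complex.Gamma_ofReal, ← Complex.ofReal_add]
        push_cast
        rw [add_comm b a, mul_comm (Real.Gamma b : ℂ), add_comm (b : ℂ)]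

theorem intervalIntegrable_sub_rpow_mul_sub_rpow {a b r t : ℝ} (ha : 0 < a) (hb : 0 < b)
    (hrt : r < t) :
    IntervalIntegrable (fun s => (t - s) ^ (a - 1) * (s - r) ^ (b - 1)) volume r t := by
  refine intervalIntegral.intervalIntegrable_of_integral_ne_zero ?_
  rw [integral_sub_rpow_mul_sub_rpow ha hb hrt]
  have h0 := sub_pos.2 hrt
  have h1 := Real.Gamma_pos_of_pos ha
  have h2 := Real.Gamma_pos_of_pos hb
  have h3 := Real.Gamma_pos_of_pos (add_pos ha hb)
  positivity

theorem hasDerivWithinAt_fracInt_one [CompleteSpace Y] {T t : ℝ} {f : ℝ → Y}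
    (hf : ContinuousOn f (Icc 0 T)) (ht : t ∈ Icc 0 T) :
    HasDerivWithinAt (fracInt 1 f) (f t) (Icc 0 T) t := by
  have hT : 0 ≤ T := ht.1.trans ht.2
  -- Extending `f` by its endpoint values gives a two-sided derivative everywhere, which is then
  -- restricted to `[0, T]`.
  have hF : Continuous (IccExtend hT ((Icc 0 T).domRestrict f)) :=
    (continuousOn_iff_continuous_domRestrict.1 hf).Icc_extend'
  have h := (hF.integral_hasStrictDerivAt 0 t).hasDerivAt.hasDerivWithinAt (s := Icc 0 T)
  have he : ∀ s ∈ Icc 0 T, IccExtend hT ((Icc 0 T).domRestrict f) s = f s := fun s hs => by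
    rw [IccExtend_of_mem hT _ hs]
    rfl
  rw [he t ht] at h
  have hI : ∀ s ∈ Icc 0 T,
      fracInt 1 f s = ∫ r in (0 : ℝ)..s, IccExtend hT ((Icc 0 T).domRestrict f) r := fun s hs => by
    rw [fracInt_one]
    refine intervalIntegral.integral_congr fun r hr => ?_
    rw [uIcc_of_le hs.1] at hr
    exact (he r ⟨hr.1, hr.2.trans hs.2⟩).symm
  exact h.congr hI (hI t ht)

theorem fracInt_eq_setIntegral {γ t : ℝ} (hγ : 0 < γ) (ht : 0 ≤ t) (f : ℝ → Y) :
    fracInt γ f t = (Real.Gamma γ)⁻¹ • ∫ s in Ioo 0 t, (t - s) ^ (γ - 1) • f s := by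
  rw [fracInt_of_pos hγ, intervalIntegral.integral_of_le ht, integral_Ioc_eq_integral_Ioo]

/-- The integrand of the iterated fractional integral, extended by zero from the triangle
`r < s` to the square. -/
def triangleKernel (a b t : ℝ) (f : ℝ → Y) (s r : ℝ) : Y :=
  {p : ℝ × ℝ | p.2 < p.1}.indicator
    (fun p => ((t - p.1) ^ (a - 1) * (p.1 - p.2) ^ (b - 1)) • f p.2) (s, r)

theorem triangleKernel_eq_indicator_Ioi (a b t : ℝ) (f : ℝ → Y) (s r : ℝ) :
    triangleKernel a b t f s r =
      (Ioi r).indicator (fun s => ((t - s) ^ (a - 1) * (s - r) ^ (b - 1)) • f r) s := by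
  simp [triangleKernel, indicator_apply]

theorem triangleKernel_eq_indicator_Iio (a b t : ℝ) (f : ℝ → Y) (s r : ℝ) :
    triangleKernel a b t f s r =
      (Iio s).indicator (fun r => ((t - s) ^ (a - 1) * (s - r) ^ (b - 1)) • f r) r := by
  simp [triangleKernel, indicator_apply]

theorem Ioo_inter_Ioi_of_le {a b c : ℝ} (h : a ≤ c) : Ioo a b ∩ Ioi c = Ioo c b := by
  ext x
  simp only [mem_inter_iff, mem_Ioo, mem_Ioi]
  constructor <;> intro hx
  · exact ⟨hx.2, hx.1.2⟩
  · exact ⟨⟨h.trans_lt hx.1, hx.2⟩, hx.1⟩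

theorem Ioo_inter_Iio_of_le {a b c : ℝ} (h : c ≤ b) : Ioo a b ∩ Iio c = Ioo a c := by
  rw [Ioo_inter_Iio, min_eq_right h]

/-- Integrating out `s` first leaves a Beta integral, hence the kernel of `I^{a+b}`; the opposite
order leaves `I^b f` under `I^a`. Fubini equates the two. -/
theorem setIntegral_triangleKernel_left [CompleteSpace Y] {a b t r : ℝ} (ha : 0 < a) (hb : 0 < b)
    (f : ℝ → Y) (hr : r ∈ Ioo 0 t) :
    ∫ s in Ioo 0 t, triangleKernel a b t f s r =
      ((t - r) ^ (a + b - 1) * (Real.Gamma a * Real.Gamma b / Real.Gamma (a + b))) • f r := by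
  simp only [triangleKernel_eq_indicator_Ioi]
  rw [setIntegral_indicator measurableSet_Ioi, Ioo_inter_Ioi_of_le hr.1.le,
    ← integral_Ioc_eq_integral_Ioo, ← intervalIntegral.integral_of_le hr.2.le,
    intervalIntegral.integral_smul_const, integral_sub_rpow_mul_sub_rpow ha hb hr.2]

theorem setIntegral_norm_triangleKernel_left {a b t r : ℝ} (ha : 0 < a) (hb : 0 < b)
    (f : ℝ → Y) (hr : r ∈ Ioo 0 t) :
    ∫ s in Ioo 0 t, ‖triangleKernel a b t f s r‖ =
      ((t - r) ^ (a + b - 1) * (Real.Gamma a * Real.Gamma b / Real.Gamma (a + b))) * ‖f r‖ := by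
  have h := setIntegral_triangleKernel_left ha hb (fun r => ‖f r‖) hr
  rw [smul_eq_mul] at h
  rw [← h]
  refine setIntegral_congr_fun measurableSet_Ioo fun s hs => ?_
  have h1 : 0 ≤ t - s := by linarith [hs.2]
  by_cases hrs : r < s
  · have h2 : 0 ≤ s - r := by linarith
    simp only [triangleKernel_eq_indicator_Ioi, indicator_of_mem (mem_Ioi.2 hrs), norm_smul]
    rw [Real.norm_of_nonneg (by positivity), smul_eq_mul]
  · simp [triangleKernel_eq_indicator_Ioi, hrs]

theorem setIntegral_triangleKernel_right {a b t s : ℝ} (hb : 0 < b)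
    (f : ℝ → Y) (hs : s ∈ Ioo 0 t) :
    ∫ r in Ioo 0 t, triangleKernel a b t f s r =
      (Real.Gamma b * (t - s) ^ (a - 1)) • fracInt b f s := by
  have hG := (Real.Gamma_pos_of_pos hb).ne'
  simp only [triangleKernel_eq_indicator_Iio]
  rw [setIntegral_indicator measurableSet_Iio, Ioo_inter_Iio_of_le hs.2.le,
    fracInt_eq_setIntegral hb hs.1.le, smul_smul, ← integral_smul]
  refine integral_congr_ae (.of_forall fun r => ?_)
  simp only [smul_smul]
  congr 1
  field_simp

/-- By Tonelli: the norm integrated in `s` is a constant times `(t - r)^{a+b-1} ‖f r‖`, which is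
integrable in `r`. -/
theorem integrable_triangleKernel {a b t : ℝ} {f : ℝ → Y} (ha : 0 < a) (hb : 0 < b) (ht : 0 ≤ t)
    (hf : ContinuousOn f (Icc 0 t)) :
    Integrable (Function.uncurry (triangleKernel a b t f))
      ((volume.restrict (Ioo 0 t)).prod (volume.restrict (Ioo 0 t))) := by
  refine (integrable_prod_iff' ?_).2 ⟨?_, ?_⟩
  · refine AEStronglyMeasurable.indicator (AEStronglyMeasurable.smul
      (Measurable.aestronglyMeasurable (by fun_prop)) ?_)
      (measurableSet_lt measurable_snd measurable_fst)
    exact ((hf.mono Ioo_subset_Icc_self).aestronglyMeasurable measurableSet_Ioo).comp_snd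
  · refine (ae_restrict_iff' measurableSet_Ioo).2 (.of_forall fun r hr => ?_)
    simp only [Function.uncurry, triangleKernel_eq_indicator_Ioi]
    rw [integrable_indicator_iff measurableSet_Ioi, IntegrableOn,
      Measure.restrict_restrict measurableSet_Ioi, inter_comm, Ioo_inter_Ioi_of_le hr.1.le]
    refine Integrable.smul_const ?_ _
    exact ((intervalIntegrable_iff_integrableOn_Ioo_of_le hr.2.le).1
      (intervalIntegrable_sub_rpow_mul_sub_rpow ha hb hr.2))
  · have h := ((intervalIntegrable_iff_integrableOn_Ioo_of_le ht).1
      (intervalIntegrable_sub_rpow_smul (add_pos ha hb) ht hf.norm)).const_mul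
      (Real.Gamma a * Real.Gamma b / Real.Gamma (a + b))
    refine IntegrableOn.congr_fun h (fun r hr => ?_) measurableSet_Ioo
    simp only [Function.uncurry]
    rw [setIntegral_norm_triangleKernel_left ha hb f hr, smul_eq_mul]
    ring

/-- The semigroup property of fractional integrals. -/
theorem fracInt_fracInt [CompleteSpace Y] {a b t : ℝ} {f : ℝ → Y} (ha : 0 ≤ a) (hb : 0 ≤ b) (ht : 0 ≤ t)
    (hf : ContinuousOn f (Icc 0 t)) :
    fracInt a (fracInt b f) t = fracInt (a + b) f t := by
  rcases ha.eq_or_lt with rfl | ha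
  · simp [fracInt_zero]
  rcases hb.eq_or_lt with rfl | hb
  · simp [fracInt_zero]
  have h := integral_integral_swap (integrable_triangleKernel ha hb ht hf)
  rw [setIntegral_congr_fun measurableSet_Ioo
      (fun s hs => setIntegral_triangleKernel_right (a := a) hb f hs),
    setIntegral_congr_fun measurableSet_Ioo
      (fun r hr => setIntegral_triangleKernel_left ha hb f hr)] at h
  have hGa := (Real.Gamma_pos_of_pos ha).ne'
  have hGb := (Real.Gamma_pos_of_pos hb).ne'
  have hGab := (Real.Gamma_pos_of_pos (add_pos ha hb)).ne'
  simp only [mul_smul, mul_comm _ (_ / _), integral_smul] at h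
  rw [fracInt_eq_setIntegral ha ht, fracInt_eq_setIntegral (add_pos ha hb) ht]
  have h2 := congrArg (fun v => (Real.Gamma a * Real.Gamma b)⁻¹ • v) h
  simp only [smul_smul] at h2
  convert h2 using 2 <;> field_simp

/-! ### The operators `Q_{k,m}` and convergence of the Mittag-Leffler series -/

theorem Q_succ_zero (A B : Y →L[ℝ] Y) (k : ℕ) : Q A B (k + 1) 0 = A * Q A B k 0 := by
  simp only [Q]
  exact pow_succ' A k

theorem Q_zero_succ (A B : Y →L[ℝ] Y) (m : ℕ) : Q A B 0 (m + 1) = B * Q A B 0 m := by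
  simp [Q]

/-- Words in `A` and `B` are split by their first letter: in the defining sum the term `l = k + 1`
starts with `B`, all others with `A`. -/
theorem Q_succ_succ (A B : Y →L[ℝ] Y) (k m : ℕ) :
    Q A B (k + 1) (m + 1) = A * Q A B k (m + 1) + B * Q A B (k + 1) m := by
  rw [Q, Finset.sum_range_succ, Q, Finset.mul_sum]
  congr 1
  · refine Finset.sum_congr rfl fun l hl => ?_
    have hl' : l ≤ k := Nat.lt_succ_iff.1 (Finset.mem_range.1 hl)
    rw [Nat.succ_sub hl', pow_succ']
    simp only [mul_assoc]
  · simp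

/-- There are `(k+m choose k) ≤ 2^{k+m}` words. In the induction each of the two summands of the
recursion contributes half of the bound. -/
theorem norm_Q_le (A B : Y →L[ℝ] Y) (k m : ℕ) :
    ‖Q A B k m‖ ≤ (2 * ‖A‖) ^ k * (2 * ‖B‖) ^ m := by
  have hA := norm_nonneg A
  have hB := norm_nonneg B
  induction k generalizing m with
  | zero =>
    rw [Q_zero_left, pow_zero, one_mul]
    cases m with
    | zero =>
      rw [pow_zero, pow_zero]
      -- Only `≤ 1` is available: `Y` may be trivial, and then the identity has norm `0`.
      exact ContinuousLinearMap.norm_id_le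
    | succ m =>
      refine (norm_pow_le' B m.succ_pos).trans (pow_le_pow_left₀ hB ?_ _)
      linarith
  | succ k ihk =>
    induction m with
    | zero =>
      rw [Q_succ_zero]
      calc ‖A * Q A B k 0‖ ≤ ‖A‖ * ((2 * ‖A‖) ^ k * (2 * ‖B‖) ^ 0) :=
            (norm_mul_le _ _).trans (by gcongr; exact ihk 0)
        _ ≤ 2 * (‖A‖ * ((2 * ‖A‖) ^ k * (2 * ‖B‖) ^ 0)) := by
            have : 0 ≤ ‖A‖ * ((2 * ‖A‖) ^ k * (2 * ‖B‖) ^ 0) := by positivity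
            linarith
        _ = _ := by ring
    | succ m ihm =>
      rw [Q_succ_succ]
      calc ‖A * Q A B k (m + 1) + B * Q A B (k + 1) m‖
          ≤ ‖A‖ * ((2 * ‖A‖) ^ k * (2 * ‖B‖) ^ (m + 1))
            + ‖B‖ * ((2 * ‖A‖) ^ (k + 1) * (2 * ‖B‖) ^ m) := by
            refine (norm_add_le _ _).trans (add_le_add ?_ ?_)
            · exact (norm_mul_le _ _).trans (by gcongr; exact ihk (m + 1))
            · exact (norm_mul_le _ _).trans (by gcongr)
        _ = _ := by ring

/-- The exponent `k a + m b` of the `(k, m)` term of the series. -/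
def termOrder (a b : ℝ) (p : ℕ × ℕ) : ℝ := (p.1 : ℝ) * a + (p.2 : ℝ) * b

theorem termOrder_nonneg {a b : ℝ} (ha : 0 ≤ a) (hb : 0 ≤ b) (p : ℕ × ℕ) :
    0 ≤ termOrder a b p := by
  unfold termOrder
  positivity

theorem exists_rpow_neg_lt {a b : ℝ} (ha : 0 < a) (hb : 0 < b) (A B : Y →L[ℝ] Y) :
    ∃ l : ℝ, 0 < l ∧ 2 * ‖A‖ * l ^ (-a) < 1 / 2 ∧ 2 * ‖B‖ * l ^ (-b) < 1 / 2 := by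
  have h1 := (tendsto_rpow_neg_atTop ha).const_mul (2 * ‖A‖)
  have h2 := (tendsto_rpow_neg_atTop hb).const_mul (2 * ‖B‖)
  rw [mul_zero] at h1 h2
  have h := ((h1.eventually (gt_mem_nhds one_half_pos)).and
    (h2.eventually (gt_mem_nhds one_half_pos))).and (Filter.eventually_gt_atTop 0)
  obtain ⟨l, ⟨h1, h2⟩, h3⟩ := h.exists
  exact ⟨l, h3, h1, h2⟩

theorem summable_norm_Q_mul_rpow {a b l : ℝ} (A B : Y →L[ℝ] Y) (hl : 0 < l)
    (hA : 2 * ‖A‖ * l ^ (-a) < 1 / 2) (hB : 2 * ‖B‖ * l ^ (-b) < 1 / 2) :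
    Summable fun p : ℕ × ℕ => ‖Q A B p.1 p.2‖ * l ^ (-termOrder a b p) := by
  have hA0 : 0 ≤ 2 * ‖A‖ * l ^ (-a) := by positivity
  have hB0 : 0 ≤ 2 * ‖B‖ * l ^ (-b) := by positivity
  have h := (summable_geometric_of_lt_one hA0 (by linarith)).mul_of_nonneg
    (summable_geometric_of_lt_one hB0 (by linarith))
    (fun k => pow_nonneg hA0 k) (fun k => pow_nonneg hB0 k)
  refine h.of_nonneg_of_le (fun p => by positivity) fun p => ?_
  have he : l ^ (-termOrder a b p) = (l ^ (-a)) ^ p.1 * (l ^ (-b)) ^ p.2 := by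
    rw [← Real.rpow_natCast, ← Real.rpow_natCast, ← Real.rpow_mul hl.le, ← Real.rpow_mul hl.le,
      ← Real.rpow_add hl, termOrder]
    congr 1
    ring
  rw [he, mul_pow, mul_pow]
  calc _ ≤ ((2 * ‖A‖) ^ p.1 * (2 * ‖B‖) ^ p.2) * ((l ^ (-a)) ^ p.1 * (l ^ (-b)) ^ p.2) := by
        gcongr
        exact norm_Q_le A B p.1 p.2
    _ = _ := by ring

/-- The left side is `I^γ 1` at time `1`, so the weighted bound replaces any asymptotics of `Γ`. -/
theorem inv_Gamma_le {γ l : ℝ} (hγ : 0 ≤ γ) (hl : 0 < l) :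
    (Real.Gamma (γ + 1))⁻¹ ≤ Real.exp l * l ^ (-γ) := by
  have h := norm_fracInt_le (f := fun _ => (1 : ℝ)) (M := 1) (t := 1) hγ hl zero_le_one
    (fun s hs => by
      rw [norm_one, one_mul]
      exact Real.one_le_exp (mul_nonneg hl.le hs.1))
  rw [fracInt_const hγ, Real.one_rpow, smul_eq_mul, mul_one, mul_one, one_mul, one_div] at h
  exact (le_abs_self _).trans h

/-- Monotonicity in time makes the terms at the right endpoint a uniform majorant on the whole
interval. -/
theorem norm_mlTerm_le {a b c s t : ℝ} (ha : 0 ≤ a) (hb : 0 ≤ b) (hc : 0 < c)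
    (A B : Y →L[ℝ] Y) (hs : 0 ≤ s) (hst : s ≤ t) (p : ℕ × ℕ) :
    ‖mlTerm a b c A B s p.1 p.2‖ ≤ ‖mlTerm a b c A B t p.1 p.2‖ := by
  have ho := termOrder_nonneg ha hb p
  have hG : 0 < Real.Gamma (termOrder a b p + c) := Real.Gamma_pos_of_pos (by linarith)
  have ht := hs.trans hst
  unfold termOrder at ho hG
  unfold mlTerm
  rw [norm_smul, norm_smul, norm_div, norm_div, Real.norm_of_nonneg (Real.rpow_nonneg hs _),
    Real.norm_of_nonneg (Real.rpow_nonneg ht _)]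
  gcongr

theorem summable_norm_mlTerm {a b c t : ℝ} (ha : 0 < a) (hb : 0 < b) (hc : 1 ≤ c)
    (A B : Y →L[ℝ] Y) (ht : 0 ≤ t) :
    Summable fun p : ℕ × ℕ => ‖mlTerm a b c A B t p.1 p.2‖ := by
  -- Negative powers of `t` appear below, so `t = 0` is avoided by comparing with time `t + 1`.
  suffices h : ∀ t : ℝ, 0 < t → Summable fun p : ℕ × ℕ => ‖mlTerm a b c A B t p.1 p.2‖ from
    (h (t + 1) (by linarith)).of_nonneg_of_le (fun p => norm_nonneg _)
      fun p => norm_mlTerm_le ha.le hb.le (by linarith) A B ht (by linarith) p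
  intro t ht
  obtain ⟨l, hl, hA, hB⟩ := exists_rpow_neg_lt ha hb A B
  refine ((summable_norm_Q_mul_rpow A B hl hA hB).mul_left
    (Real.exp (t * l) * (t * l) ^ (1 - c))).of_nonneg_of_le (fun p => norm_nonneg _) fun p => ?_
  have ho := termOrder_nonneg ha.le hb.le p
  have hG : 0 < Real.Gamma (termOrder a b p + c) := Real.Gamma_pos_of_pos (by linarith)
  -- The weight `t * l` is chosen so that the powers of `t` cancel and `l^{-(ka+mb)}` remains.
  have h1 := inv_Gamma_le (γ := termOrder a b p + c - 1) (by linarith) (mul_pos ht hl)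
  rw [sub_add_cancel] at h1
  have h2 : (t * l) ^ (-(termOrder a b p + c - 1))
      = (t * l) ^ (1 - c) * (t ^ (-termOrder a b p) * l ^ (-termOrder a b p)) := by
    rw [← Real.mul_rpow ht.le hl.le, ← Real.rpow_add (mul_pos ht hl)]
    congr 1
    ring
  have h3 : t ^ termOrder a b p * t ^ (-termOrder a b p) = 1 := by
    rw [← Real.rpow_add ht, add_neg_cancel, Real.rpow_zero]
  have h4 : ‖mlTerm a b c A B t p.1 p.2‖
      = t ^ termOrder a b p * (Real.Gamma (termOrder a b p + c))⁻¹ * ‖Q A B p.1 p.2‖ := by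
    rw [mlTerm, norm_smul, Real.norm_of_nonneg, div_eq_mul_inv]
    · rfl
    · exact div_nonneg (Real.rpow_nonneg ht.le _) hG.le
  rw [h4]
  calc _ ≤ t ^ termOrder a b p * (Real.exp (t * l) * (t * l) ^ (-(termOrder a b p + c - 1)))
          * ‖Q A B p.1 p.2‖ := by gcongr
    _ = (t ^ termOrder a b p * t ^ (-termOrder a b p)) * (Real.exp (t * l) * (t * l) ^ (1 - c)
          * (‖Q A B p.1 p.2‖ * l ^ (-termOrder a b p))) := by
        rw [h2]
        ring
    _ = _ := by rw [h3, one_mul]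

theorem hasSum_mittagLeffler [CompleteSpace Y] {a b c t : ℝ} (ha : 0 < a) (hb : 0 < b) (hc : 1 ≤ c)
    (A B : Y →L[ℝ] Y) (ht : 0 ≤ t) :
    HasSum (fun p : ℕ × ℕ => mlTerm a b c A B t p.1 p.2) (mittagLeffler a b c A B t) := by
  have h := (summable_norm_mlTerm ha hb hc A B ht).of_norm
  rw [mittagLeffler, ← h.tsum_prod]
  exact h.hasSum

theorem hasSum_mittagLeffler_apply [CompleteSpace Y] {a b c t : ℝ} (ha : 0 < a) (hb : 0 < b) (hc : 1 ≤ c)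
    (A B : Y →L[ℝ] Y) (ht : 0 ≤ t) (v : Y) :
    HasSum (fun p : ℕ × ℕ => mlTerm a b c A B t p.1 p.2 v) (mittagLeffler a b c A B t v) :=
  (hasSum_mittagLeffler ha hb hc A B ht).map
    (AddMonoidHom.mk' (fun S : Y →L[ℝ] Y => S v) fun _ _ => rfl)
    (continuous_id.clm_apply continuous_const)

theorem continuousOn_mlTerm {a b c : ℝ} (ha : 0 ≤ a) (hb : 0 ≤ b) (A B : Y →L[ℝ] Y)
    (p : ℕ × ℕ) (s : Set ℝ) : ContinuousOn (fun t => mlTerm a b c A B t p.1 p.2) s := by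
  have ho := termOrder_nonneg ha hb p
  exact (((Real.continuous_rpow_const ho).div_const _).smul continuous_const).continuousOn

theorem continuousOn_mittagLeffler [CompleteSpace Y] {a b c : ℝ} (ha : 0 < a) (hb : 0 < b) (hc : 1 ≤ c)
    (A B : Y →L[ℝ] Y) {T : ℝ} (hT : 0 ≤ T) :
    ContinuousOn (mittagLeffler a b c A B) (Icc 0 T) := by
  refine ContinuousOn.congr (continuousOn_tsum
    (fun p => continuousOn_mlTerm ha.le hb.le A B p (Icc 0 T))
    (summable_norm_mlTerm (c := c) ha hb hc A B hT)
    fun p t ht => norm_mlTerm_le ha.le hb.le (by linarith) A B ht.1 ht.2 p) fun t ht => ?_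
  exact (hasSum_mittagLeffler ha hb hc A B ht.1).tsum_eq.symm

theorem continuousOn_convolution_integrand [CompleteSpace Y] {a b : ℝ} (ha : 0 < a) (hb : 1 < b)
    (A B : Y →L[ℝ] Y) {g : ℝ → Y} {t : ℝ} (ht : 0 ≤ t) (hg : ContinuousOn g (Icc 0 t)) :
    ContinuousOn (fun s => (t - s) ^ (b - 1) • mittagLeffler a b b A B (t - s) (g s))
      (Icc 0 t) := by
  have h1 : Continuous fun s : ℝ => (t - s) ^ (b - 1) :=
    (Real.continuous_rpow_const (by linarith)).comp (by fun_prop)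
  have h2 : ContinuousOn (fun s => mittagLeffler a b b A B (t - s)) (Icc 0 t) :=
    (continuousOn_mittagLeffler ha (by linarith) hb.le A B ht).comp (by fun_prop)
      fun s hs => ⟨by linarith [hs.2], by linarith [hs.1]⟩
  exact h1.continuousOn.smul (h2.clm_apply hg)

/-! ### The resolvent and uniqueness for the Volterra equation -/

theorem hasSum_fracInt {ι : Type*} [Countable ι] {γ t : ℝ} {F : ι → ℝ → Y} {G : ℝ → Y}
    {u : ι → ℝ} (hγ : 0 ≤ γ) (ht : 0 ≤ t) (hu : Summable u)
    (hF : ∀ i, ContinuousOn (F i) (Icc 0 t)) (hFu : ∀ i, ∀ s ∈ Icc 0 t, ‖F i s‖ ≤ u i)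
    (hFG : ∀ s ∈ Icc 0 t, HasSum (fun i => F i s) (G s)) :
    HasSum (fun i => fracInt γ (F i) t) (fracInt γ G t) := by
  rcases hγ.eq_or_lt with rfl | hγ
  · simpa only [fracInt_zero] using hFG t ⟨ht, le_rfl⟩
  simp only [fracInt_of_pos hγ]
  refine HasSum.const_smul _ ?_
  have hmem : ∀ s ∈ uIoc 0 t, s ∈ Icc 0 t := fun s hs => by
    rw [uIoc_of_le ht] at hs
    exact Ioc_subset_Icc_self hs
  refine intervalIntegral.hasSum_integral_of_dominated_convergence
    (fun i s => (t - s) ^ (γ - 1) * u i) (fun i => ?_) (fun i => ?_) ?_ ?_ ?_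
  · exact (intervalIntegrable_sub_rpow_smul hγ ht (hF i)).def'.aestronglyMeasurable
  · refine .of_forall fun s hs => ?_
    have : 0 ≤ (t - s) ^ (γ - 1) := Real.rpow_nonneg (by linarith [(hmem s hs).2]) _
    rw [norm_smul, Real.norm_of_nonneg this]
    exact mul_le_mul_of_nonneg_left (hFu i s (hmem s hs)) this
  · exact .of_forall fun s _ => hu.mul_left _
  · simp only [tsum_mul_left]
    exact (intervalIntegrable_sub_rpow hγ t).mul_const _
  · exact .of_forall fun s hs => (hFG s (hmem s hs)).const_smul _

/-- The resolvent of the Volterra operator `A I^a + B I^b`, as the series of the operators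
`Q_{k,m} I^{k a + m b}`. -/
def resolvent (a b : ℝ) (A B : Y →L[ℝ] Y) (f : ℝ → Y) (t : ℝ) : Y :=
  ∑' p : ℕ × ℕ, Q A B p.1 p.2 (fracInt (termOrder a b p) f t)

theorem exists_bound_resolvent_term {a b T : ℝ} (ha : 0 < a) (hb : 0 < b) (A B : Y →L[ℝ] Y)
    {f : ℝ → Y} (hf : ContinuousOn f (Icc 0 T)) :
    ∃ u : ℕ × ℕ → ℝ, Summable u ∧ ∀ p, ∀ t ∈ Icc 0 T,
      ‖Q A B p.1 p.2 (fracInt (termOrder a b p) f t)‖ ≤ u p := by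
  obtain ⟨l, hl, hA, hB⟩ := exists_rpow_neg_lt ha hb A B
  obtain ⟨M, hM⟩ := isCompact_Icc.exists_bound_of_continuousOn hf
  refine ⟨_, (summable_norm_Q_mul_rpow A B hl hA hB).mul_left (M * Real.exp (l * T)),
    fun p t ht => ?_⟩
  have hM0 : 0 ≤ M := (norm_nonneg _).trans (hM t ht)
  have h := norm_fracInt_le (M := M) (f := f) (termOrder_nonneg ha.le hb.le p) hl ht.1
    fun s hs => (hM s ⟨hs.1, hs.2.trans ht.2⟩).trans
      (le_mul_of_one_le_right hM0 (Real.one_le_exp (mul_nonneg hl.le hs.1)))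
  calc _ ≤ ‖Q A B p.1 p.2‖ * ‖fracInt (termOrder a b p) f t‖ := ContinuousLinearMap.le_opNorm _ _
    _ ≤ ‖Q A B p.1 p.2‖ * (M * Real.exp (l * T) * l ^ (-termOrder a b p)) := by
        gcongr
        refine h.trans ?_
        gcongr
        exact ht.2
    _ = _ := by ring

theorem hasSum_resolvent [CompleteSpace Y] {a b T t : ℝ} (ha : 0 < a) (hb : 0 < b) (A B : Y →L[ℝ] Y)
    {f : ℝ → Y} (hf : ContinuousOn f (Icc 0 T)) (ht : t ∈ Icc 0 T) :
    HasSum (fun p : ℕ × ℕ => Q A B p.1 p.2 (fracInt (termOrder a b p) f t))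
      (resolvent a b A B f t) := by
  obtain ⟨u, hu, hb⟩ := exists_bound_resolvent_term ha hb A B hf
  exact (Summable.of_norm_bounded hu fun p => hb p t ht).hasSum

theorem continuousOn_resolvent_term {a b T : ℝ} (ha : 0 < a) (hb : 0 < b) (A B : Y →L[ℝ] Y)
    {f : ℝ → Y} (hf : ContinuousOn f (Icc 0 T)) (p : ℕ × ℕ) :
    ContinuousOn (fun t => Q A B p.1 p.2 (fracInt (termOrder a b p) f t)) (Icc 0 T) :=
  (Q A B p.1 p.2).continuous.comp_continuousOn
    (continuousOn_fracInt (termOrder_nonneg ha.le hb.le p) hf)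

theorem continuousOn_resolvent [CompleteSpace Y] {a b T : ℝ} (ha : 0 < a) (hb : 0 < b) (A B : Y →L[ℝ] Y)
    {f : ℝ → Y} (hf : ContinuousOn f (Icc 0 T)) :
    ContinuousOn (resolvent a b A B f) (Icc 0 T) := by
  obtain ⟨u, hu, hbd⟩ := exists_bound_resolvent_term ha hb A B hf
  exact continuousOn_tsum (continuousOn_resolvent_term ha hb A B hf) hu hbd

/-- `I^γ` passes through the uniformly dominated sum and through each `Q_{k,m}`; the semigroup law
then adds the orders. -/
theorem hasSum_fracInt_resolvent [CompleteSpace Y] {a b γ T t : ℝ} (ha : 0 < a) (hb : 0 < b) (hγ : 0 ≤ γ)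
    (A B : Y →L[ℝ] Y) {f : ℝ → Y} (hf : ContinuousOn f (Icc 0 T)) (ht : t ∈ Icc 0 T) :
    HasSum (fun p : ℕ × ℕ => Q A B p.1 p.2 (fracInt (γ + termOrder a b p) f t))
      (fracInt γ (resolvent a b A B f) t) := by
  obtain ⟨u, hu, hbd⟩ := exists_bound_resolvent_term ha hb A B hf
  have hsub : Icc 0 t ⊆ Icc 0 T := Icc_subset_Icc_right ht.2
  have h := hasSum_fracInt hγ ht.1 hu
    (fun p => (continuousOn_resolvent_term ha hb A B hf p).mono hsub)
    (fun p s hs => hbd p s (hsub hs)) (fun s hs => hasSum_resolvent ha hb A B hf (hsub hs))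
  refine h.congr_fun fun p => ?_
  have ho := termOrder_nonneg ha.le hb.le p
  rw [fracInt_clm hγ ht.1 ((continuousOn_fracInt ho hf).mono hsub),
    fracInt_fracInt hγ ho ht.1 (hf.mono hsub)]

/-- The resolvent solves the Volterra equation. -/
theorem resolvent_eq [CompleteSpace Y] {a b T t : ℝ} (ha : 0 < a) (hb : 0 < b) (A B : Y →L[ℝ] Y)
    {f : ℝ → Y} (hf : ContinuousOn f (Icc 0 T)) (ht : t ∈ Icc 0 T) :
    resolvent a b A B f t = f t + A (fracInt a (resolvent a b A B f) t)
      + B (fracInt b (resolvent a b A B f) t) := by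
  -- `U` and `V` are the series of the `A` and `B` terms, reindexed by `k + 1` and `m + 1` and
  -- padded by zero. With `f` at `(0, 0)` they add up to the resolvent series, by the recursion for
  -- `Q`.
  let U : ℕ × ℕ → Y := fun p => match p with
    | (0, _) => 0
    | (k + 1, m) => A (Q A B k m (fracInt (termOrder a b (k + 1, m)) f t))
  let V : ℕ × ℕ → Y := fun p => match p with
    | (_, 0) => 0
    | (k, m + 1) => B (Q A B k m (fracInt (termOrder a b (k, m + 1)) f t))
  have hU : HasSum U (A (fracInt a (resolvent a b A B f) t)) := by
    have hi : Function.Injective fun p : ℕ × ℕ => (p.1 + 1, p.2) := fun p q h => by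
      simp only [Prod.mk.injEq, add_left_inj] at h
      exact Prod.ext h.1 h.2
    refine (hi.hasSum_iff ?_).1 ?_
    · rintro ⟨_ | k, m⟩ h
      · rfl
      · exact absurd ⟨(k, m), rfl⟩ h
    · refine (A.hasSum (hasSum_fracInt_resolvent ha hb ha.le A B hf ht)).congr_fun fun p => ?_
      have : termOrder a b (p.1 + 1, p.2) = a + termOrder a b p := by
        simp only [termOrder]
        push_cast
        ring
      simp only [U, Function.comp_apply, this]
  have hV : HasSum V (B (fracInt b (resolvent a b A B f) t)) := by
    have hi : Function.Injective fun p : ℕ × ℕ => (p.1, p.2 + 1) := fun p q h => by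
      simp only [Prod.mk.injEq, add_left_inj] at h
      exact Prod.ext h.1 h.2
    refine (hi.hasSum_iff ?_).1 ?_
    · rintro ⟨k, _ | m⟩ h
      · rfl
      · exact absurd ⟨(k, m), rfl⟩ h
    · refine (B.hasSum (hasSum_fracInt_resolvent ha hb hb.le A B hf ht)).congr_fun fun p => ?_
      have : termOrder a b (p.1, p.2 + 1) = b + termOrder a b p := by
        simp only [termOrder]
        push_cast
        ring
      simp only [V, Function.comp_apply, this]
  have hW : HasSum (fun p : ℕ × ℕ => if p = (0, 0) then f t else 0) (f t) :=
    hasSum_ite_eq (0, 0) (f t)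
  refine (hasSum_resolvent ha hb A B hf ht).unique (((hW.add hU).add hV).congr_fun ?_)
  rintro ⟨_ | k, _ | m⟩
  · simp [U, V, termOrder, fracInt_zero, Q]
  · simp [U, V, Q_zero_succ]
  · simp [U, V, Q_succ_zero]
  · simp [U, V, Q_succ_succ]

/-- At a maximum point `r` of `‖z s‖ e^{-ls}` the equation and the weighted bound give `M ≤ (‖A‖
l^{-a} + ‖B‖ l^{-b}) M`, and the choice of `l` makes the factor less than `1/2`. -/
theorem eq_zero_of_volterra {a b T : ℝ} (ha : 0 < a) (hb : 0 < b) (A B : Y →L[ℝ] Y)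
    {z : ℝ → Y} (hz : ContinuousOn z (Icc 0 T))
    (h : ∀ t ∈ Icc 0 T, z t = A (fracInt a z t) + B (fracInt b z t)) :
    ∀ t ∈ Icc 0 T, z t = 0 := by
  intro t ht
  obtain ⟨l, hl, hA, hB⟩ := exists_rpow_neg_lt ha hb A B
  have hc : ContinuousOn (fun s => ‖z s‖ * Real.exp (-(l * s))) (Icc 0 T) :=
    hz.norm.mul (by fun_prop)
  obtain ⟨r, hr, hmax⟩ := isCompact_Icc.exists_isMaxOn ⟨t, ht⟩ hc
  set M := ‖z r‖ * Real.exp (-(l * r)) with hM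
  have hM0 : 0 ≤ M := by positivity
  have hbd : ∀ s ∈ Icc 0 T, ‖z s‖ ≤ M * Real.exp (l * s) := fun s hs => by
    have h1 : ‖z s‖ * Real.exp (-(l * s)) ≤ M := hmax hs
    rwa [Real.exp_neg, ← div_eq_mul_inv, div_le_iff₀ (Real.exp_pos _)] at h1
  have hzr : ‖z r‖ = M * Real.exp (l * r) := by
    rw [hM, mul_assoc, ← Real.exp_add]
    simp
  have hbr : ∀ s ∈ Icc 0 r, ‖z s‖ ≤ M * Real.exp (l * s) := fun s hs =>
    hbd s ⟨hs.1, hs.2.trans hr.2⟩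
  have h1 : ‖z r‖ ≤ ‖A‖ * (M * Real.exp (l * r) * l ^ (-a))
      + ‖B‖ * (M * Real.exp (l * r) * l ^ (-b)) := by
    rw [h r hr]
    refine (norm_add_le _ _).trans (add_le_add ?_ ?_)
    · exact (A.le_opNorm _).trans (by gcongr; exact norm_fracInt_le ha.le hl hr.1 hbr)
    · exact (B.le_opNorm _).trans (by gcongr; exact norm_fracInt_le hb.le hl hr.1 hbr)
  rw [hzr] at h1
  have hE : 0 ≤ M * Real.exp (l * r) := by positivity
  have h2 : M * Real.exp (l * r) ≤ 0 := by
    nlinarith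
  have hM1 : M ≤ 0 := nonpos_of_mul_nonpos_left h2 (Real.exp_pos _)
  have h3 := hbd t ht
  rw [le_antisymm hM1 hM0, zero_mul] at h3
  exact norm_le_zero_iff.1 h3

theorem eqOn_of_volterra {a b T : ℝ} (ha : 0 < a) (hb : 0 < b) (A B : Y →L[ℝ] Y)
    {f z w : ℝ → Y} (hz : ContinuousOn z (Icc 0 T)) (hw : ContinuousOn w (Icc 0 T))
    (hzf : ∀ t ∈ Icc 0 T, z t = f t + A (fracInt a z t) + B (fracInt b z t))
    (hwf : ∀ t ∈ Icc 0 T, w t = f t + A (fracInt a w t) + B (fracInt b w t)) :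
    EqOn z w (Icc 0 T) := by
  intro t ht
  refine sub_eq_zero.1 (eq_zero_of_volterra ha hb A B (hz.sub hw) (fun s hs => ?_) t ht)
  have hsub : Icc 0 s ⊆ Icc 0 T := Icc_subset_Icc_right hs.2
  have h1 : ∀ γ, 0 ≤ γ → fracInt γ (z - w) s = fracInt γ z s - fracInt γ w s := fun γ hγ =>
    fracInt_sub hγ hs.1 (hz.mono hsub) (hw.mono hsub)
  rw [h1 a ha.le, h1 b hb.le, Pi.sub_apply, hzf s hs, hwf s hs, map_sub, map_sub]
  abel

/-! ### Calculus on intervals with one-sided derivatives -/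

theorem fracInt_apply_zero_of_eq_zero {γ : ℝ} {f : ℝ → Y} (hγ : 0 ≤ γ) (hf : f 0 = 0) :
    fracInt γ f 0 = 0 := by
  rcases hγ.eq_or_lt with rfl | hγ
  · rwa [fracInt_zero]
  · exact fracInt_apply_zero hγ f

theorem fracInt_congr_Ioc {γ t : ℝ} {f g : ℝ → Y} (hγ : 0 < γ) (ht : 0 ≤ t)
    (h : EqOn f g (Ioc 0 t)) : fracInt γ f t = fracInt γ g t := by
  rw [fracInt_of_pos hγ, fracInt_of_pos hγ]
  congr 1
  refine intervalIntegral.integral_congr_ae (.of_forall fun s hs => ?_)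
  rw [uIoc_of_le ht] at hs
  rw [h hs]

theorem fracInt_comp [CompleteSpace Y] {a b c t T : ℝ} {f : ℝ → Y} (ha : 0 ≤ a) (hb : 0 ≤ b)
    (hc : a + b = c) (hf : ContinuousOn f (Icc 0 T)) (ht : t ∈ Icc 0 T) :
    fracInt a (fracInt b f) t = fracInt c f t := by
  rw [fracInt_fracInt ha hb ht.1 (hf.mono (Icc_subset_Icc_right ht.2)), hc]

theorem continuousOn_clm_apply {f : ℝ → Y} {s : Set ℝ} (A : Y →L[ℝ] Y)
    (hf : ContinuousOn f s) : ContinuousOn (fun t => A (f t)) s :=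
  A.continuous.comp_continuousOn hf

theorem continuousOn_clm_apply_add {f g : ℝ → Y} {s : Set ℝ} (A : Y →L[ℝ] Y)
    (hf : ContinuousOn f s) (hg : ContinuousOn g s) :
    ContinuousOn (fun t => A (f t) + g t) s :=
  (continuousOn_clm_apply A hf).add hg

theorem fracInt_clm_add [CompleteSpace Y] {γ t T : ℝ} {f g : ℝ → Y} (hγ : 0 ≤ γ)
    (A : Y →L[ℝ] Y) (hf : ContinuousOn f (Icc 0 T)) (hg : ContinuousOn g (Icc 0 T))
    (ht : t ∈ Icc 0 T) :
    fracInt γ (fun s => A (f s) + g s) t = A (fracInt γ f t) + fracInt γ g t := by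
  have hsub : Icc 0 t ⊆ Icc 0 T := Icc_subset_Icc_right ht.2
  rw [fracInt_add hγ ht.1 (continuousOn_clm_apply A (hf.mono hsub)) (hg.mono hsub),
    fracInt_clm hγ ht.1 (hf.mono hsub)]

theorem fracInt_one_const [CompleteSpace Y] (v : Y) (t : ℝ) :
    fracInt 1 (fun _ => v) t = t • v := by
  simp [fracInt_one]

/-- The fundamental theorem of calculus. -/
theorem fracInt_one_eq_sub [CompleteSpace Y] {t T : ℝ} {f f' : ℝ → Y}
    (hf : ContinuousOn f (Icc 0 T)) (hf' : ContinuousOn f' (Icc 0 T))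
    (hd : ∀ s ∈ Ioo 0 T, HasDerivAt f (f' s) s) (ht : t ∈ Icc 0 T) :
    fracInt 1 f' t = f t - f 0 := by
  have hsub : Icc 0 t ⊆ Icc 0 T := Icc_subset_Icc_right ht.2
  rw [fracInt_one]
  refine intervalIntegral.integral_eq_sub_of_hasDerivAt_of_le ht.1 (hf.mono hsub)
    (fun s hs => hd s ⟨hs.1, hs.2.trans_le ht.2⟩) ?_
  refine ContinuousOn.intervalIntegrable ?_
  rw [uIcc_of_le ht.1]
  exact hf'.mono hsub

theorem contDiffOn_one_of_hasDerivWithinAt {f f' : ℝ → Y} {s : Set ℝ} (hs : UniqueDiffOn ℝ s)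
    (hf : ∀ t ∈ s, HasDerivWithinAt f (f' t) s t) (hf' : ContinuousOn f' s) :
    ContDiffOn ℝ 1 f s :=
  (contDiffOn_one_iff_derivWithin hs).2 ⟨fun t ht => (hf t ht).differentiableWithinAt,
    hf'.congr fun t ht => (hf t ht).derivWithin (hs t ht)⟩

theorem contDiffOn_two_of_hasDerivWithinAt {f f' f'' : ℝ → Y} {s : Set ℝ}
    (hs : UniqueDiffOn ℝ s) (hf : ∀ t ∈ s, HasDerivWithinAt f (f' t) s t)
    (hf' : ∀ t ∈ s, HasDerivWithinAt f' (f'' t) s t) (hf'' : ContinuousOn f'' s) :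
    ContDiffOn ℝ 2 f s := by
  rw [show (2 : WithTop ℕ∞) = 1 + 1 by norm_num, contDiffOn_succ_iff_derivWithin hs]
  refine ⟨fun t ht => (hf t ht).differentiableWithinAt, by simp, ?_⟩
  exact (contDiffOn_one_of_hasDerivWithinAt hs hf' hf'').congr
    fun t ht => (hf t ht).derivWithin (hs t ht)

theorem iteratedDerivWithin_two_of_hasDerivWithinAt {f f' : ℝ → Y} {v : Y} {s : Set ℝ} {t : ℝ}
    (hs : UniqueDiffOn ℝ s) (hf : ∀ t ∈ s, HasDerivWithinAt f (f' t) s t)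
    (ht : t ∈ s) (hf' : HasDerivWithinAt f' v s t) :
    iteratedDerivWithin 2 f s t = v := by
  rw [iteratedDerivWithin_succ]
  have h : EqOn (iteratedDerivWithin 1 f s) f' s := fun r hr => by
    rw [iteratedDerivWithin_one]
    exact (hf r hr).derivWithin (hs r hr)
  rw [derivWithin_congr h (h ht)]
  exact hf'.derivWithin (hs t ht)

/-! ### The Cauchy problem and the Volterra equation -/

theorem natCeil_eq_one {β : ℝ} (h0 : 0 < β) (h1 : β ≤ 1) : ⌈β⌉₊ = 1 := by
  rw [Nat.ceil_eq_iff one_ne_zero]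
  norm_num [h0, h1]

theorem natCeil_eq_two {α : ℝ} (h1 : 1 < α) (h2 : α ≤ 2) : ⌈α⌉₊ = 2 := by
  rw [Nat.ceil_eq_iff two_ne_zero]
  norm_num [h1, h2]

theorem caputoPrimitive_of_le_one {β : ℝ} (h0 : 0 < β) (h1 : β ≤ 1) (T : ℝ) (x : ℝ → Y) :
    caputoPrimitive β T x = fracInt (1 - β) fun t => x t - x 0 := by
  simp [caputoPrimitive, natCeil_eq_one h0 h1, taylorZero]

theorem caputoPrimitive_of_le_two {α : ℝ} (h1 : 1 < α) (h2 : α ≤ 2) (T : ℝ) (x : ℝ → Y) :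
    caputoPrimitive α T x =
      fracInt (2 - α) fun t => x t - (x 0 + t • derivWithin x (Icc 0 T) 0) := by
  simp [caputoPrimitive, natCeil_eq_two h1 h2, taylorZero, Finset.sum_range_succ,
    iteratedDerivWithin_one]

/-- The Volterra equation from the equation integrated once. -/
theorem volterra_of_integrated [CompleteSpace Y] {α β T : ℝ} (hα1 : 1 < α) (hα2 : α ≤ 2)
    (hβ1 : β ≤ 1) (A B : Y →L[ℝ] Y) {g x x' : ℝ → Y} {η η' : Y}
    (hg : ContinuousOn g (Icc 0 T)) (hx : ContinuousOn x (Icc 0 T))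
    (hx' : ContinuousOn x' (Icc 0 T)) (hxx' : ∀ t ∈ Icc 0 T, fracInt 1 x' t = x t - η)
    (h : ∀ t ∈ Icc 0 T, fracInt (2 - α) (fun s => x' s - η') t =
      A (fracInt (1 - β) (fun s => x s - η) t) + fracInt 1 (fun s => B (x s) + g s) t) :
    ∀ t ∈ Icc 0 T, x t - η = (t • η' + fracInt α (fun s => B η + g s) t)
      + A (fracInt (α - β) (fun s => x s - η) t) + B (fracInt α (fun s => x s - η) t) := by
  intro t ht
  have hsub : Icc 0 t ⊆ Icc 0 T := Icc_subset_Icc_right ht.2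
  have hz : ContinuousOn (fun s => x s - η) (Icc 0 T) := hx.sub continuousOn_const
  have hp : ContinuousOn (fun s => x' s - η') (Icc 0 T) := hx'.sub continuousOn_const
  have hBg : ContinuousOn (fun s => B η + g s) (Icc 0 T) := continuousOn_const.add hg
  have hBx : ContinuousOn (fun s => B (x s) + g s) (Icc 0 T) :=
    continuousOn_clm_apply_add B hx hg
  -- Applying `I^{α-1}` to the hypothesis turns its left side into `I^1 (x' - η')`.
  have h1 : fracInt (α - 1) (fracInt (2 - α) fun s => x' s - η') t = x t - η - t • η' := by
    rw [fracInt_comp (c := 1) (by linarith) (by linarith) (by ring) hp ht,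
      fracInt_sub zero_le_one ht.1 (hx'.mono hsub) continuousOn_const, hxx' t ht,
      fracInt_one_const]
  have h2 : fracInt α (fun s => B (x s) + g s) t
      = B (fracInt α (fun s => x s - η) t) + fracInt α (fun s => B η + g s) t := by
    rw [← fracInt_clm_add (by linarith) B hz hBg ht]
    refine fracInt_congr ht.1 fun s _ => ?_
    simp only [map_sub]
    abel
  rw [fracInt_congr ht.1 fun s hs => h s (hsub hs),
    fracInt_clm_add (by linarith) A (continuousOn_fracInt (by linarith) hz)
      (continuousOn_fracInt zero_le_one hBx) ht,
    fracInt_comp (c := α - β) (by linarith) (by linarith) (by ring) hz ht,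
    fracInt_comp (c := α) (by linarith) (by linarith) (by ring) hBx ht, h2] at h1
  rw [← sub_add_cancel (x t - η) (t • η'), ← h1]
  abel

/-- The Caputo primitive of order `α` is `I^1 I^{2-α} (x' - η')`, so `D^α x` is the first derivative
of the continuous function `I^{2-α} (x' - η')`, and (1) can be integrated once. -/
theorem IsMildSolution.volterra [CompleteSpace Y] {α β T : ℝ} (hα1 : 1 < α) (hα2 : α ≤ 2)
    (hβ0 : 0 < β) (hβ1 : β ≤ 1) (hT : 0 < T) {A B : Y →L[ℝ] Y} {g x : ℝ → Y} {η η' : Y}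
    (hg : ContinuousOn g (Icc 0 T)) (hx : IsMildSolution α β T A B g η η' x) :
    ∀ t ∈ Icc 0 T, x t - η = (t • η' + fracInt α (fun s => B η + g s) t)
      + A (fracInt (α - β) (fun s => x s - η) t) + B (fracInt α (fun s => x s - η) t) := by
  have hu := uniqueDiffOn_Icc hT
  have huo := uniqueDiffOn_Ioc 0 T
  obtain ⟨hd, hx'⟩ := (contDiffOn_one_iff_derivWithin hu).1 hx.contDiffOn
  have hxc := hx.contDiffOn.continuousOn
  set x' := derivWithin x (Icc 0 T) with hx'_def
  have hD : ∀ t ∈ Icc 0 T, HasDerivWithinAt x (x' t) (Icc 0 T) t := fun t ht =>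
    (hd t ht).hasDerivWithinAt
  have hxx' : ∀ t ∈ Icc 0 T, fracInt 1 x' t = x t - η := fun t ht => by
    rw [← hx.init_zero]
    exact fracInt_one_eq_sub hxc hx'
      (fun s hs => (hD s (Ioo_subset_Icc_self hs)).hasDerivAt (Icc_mem_nhds hs.1 hs.2)) ht
  refine volterra_of_integrated hα1 hα2 hβ1 A B hg hxc hx' hxx' ?_
  have hz : ContinuousOn (fun s => x s - η) (Icc 0 T) := hxc.sub continuousOn_const
  have hp : ContinuousOn (fun s => x' s - η') (Icc 0 T) := hx'.sub continuousOn_const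
  have hBx : ContinuousOn (fun s => B (x s) + g s) (Icc 0 T) :=
    continuousOn_clm_apply_add B hxc hg
  have hpc := continuousOn_fracInt (γ := 2 - α) (by linarith) hp
  have hzc := continuousOn_fracInt (γ := 1 - β) (by linarith) hz
  have hU : ∀ t ∈ Icc 0 T, caputoPrimitive α T x t =
      fracInt 1 (fracInt (2 - α) fun s => x' s - η') t := fun t ht => by
    have hsub : Icc 0 t ⊆ Icc 0 T := Icc_subset_Icc_right ht.2
    rw [caputoPrimitive_of_le_two hα1 hα2, hx.init_zero, hx.init_one,
      fracInt_comp (c := 3 - α) zero_le_one (by linarith) (by ring) hp ht,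
      ← fracInt_comp (a := 2 - α) (b := 1) (by linarith) zero_le_one (by ring) hp ht]
    refine fracInt_congr ht.1 fun s hs => ?_
    rw [fracInt_sub zero_le_one hs.1 (hx'.mono (Icc_subset_Icc_right (hsub hs).2))
      continuousOn_const, hxx' s (hsub hs), fracInt_one_const]
    abel
  have hU' : ∀ t ∈ Ioc 0 T, HasDerivWithinAt (caputoPrimitive α T x)
      (fracInt (2 - α) (fun s => x' s - η') t) (Ioc 0 T) t := fun t ht =>
    ((hasDerivWithinAt_fracInt_one hpc (Ioc_subset_Icc_self ht)).congr hU
      (hU t (Ioc_subset_Icc_self ht))).mono Ioc_subset_Icc_self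
  have hCα := hx.caputo_alpha
  have hCβ := hx.caputo_beta
  rw [CaputoDifferentiable, natCeil_eq_two hα1 hα2] at hCα
  rw [CaputoDifferentiable, natCeil_eq_one hβ0 hβ1, caputoPrimitive_of_le_one hβ0 hβ1,
    hx.init_zero] at hCβ
  have hα : ∀ t ∈ Ioo 0 T, HasDerivAt (fracInt (2 - α) fun s => x' s - η')
      (caputo α T x t) t := fun t ht => by
    have ht' := Ioo_subset_Ioc_self ht
    have h1 : DifferentiableOn ℝ (iteratedDerivWithin 1 (caputoPrimitive α T x) (Ioc 0 T))
        (Ioc 0 T) := hCα.differentiableOn_iteratedDerivWithin (by norm_num) huo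
    have h2 := (h1 t ht').hasDerivWithinAt
    rw [← iteratedDerivWithin_succ] at h2
    have h3 : EqOn (fracInt (2 - α) fun s => x' s - η')
        (iteratedDerivWithin 1 (caputoPrimitive α T x) (Ioc 0 T)) (Ioc 0 T) := fun r hr => by
      rw [iteratedDerivWithin_one]
      exact ((hU' r hr).derivWithin (huo r hr)).symm
    rw [caputo, natCeil_eq_two hα1 hα2]
    exact (h2.congr h3 (h3 ht')).hasDerivAt (Ioc_mem_nhds ht.1 ht.2)
  have hβ : ∀ t ∈ Ioo 0 T, HasDerivAt (fracInt (1 - β) fun s => x s - η)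
      (caputo β T x t) t := fun t ht => by
    have h2 := (hCβ.differentiableOn (by norm_num) t (Ioo_subset_Ioc_self ht)).hasDerivWithinAt
    rw [caputo, natCeil_eq_one hβ0 hβ1, iteratedDerivWithin_one,
      caputoPrimitive_of_le_one hβ0 hβ1, hx.init_zero]
    exact h2.hasDerivAt (Ioc_mem_nhds ht.1 ht.2)
  intro t ht
  -- Each Caputo derivative alone is controlled only on `(0, T]`. The combination equals `B x + g`,
  -- continuous up to `0`, so the fundamental theorem is applied to the difference.
  have h := fracInt_one_eq_sub (hpc.sub (A.continuous.comp_continuousOn hzc)) hBx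
    (fun s hs => by
      rw [← hx.equation s (Ioo_subset_Ioc_self hs)]
      exact (hα s hs).sub (A.hasFDerivAt.comp_hasDerivAt s (hβ s hs))) ht
  -- For `α = 2` or `β = 1` the order is `0`, and the initial conditions are what make the boundary
  -- values vanish.
  have h0 : fracInt (2 - α) (fun s => x' s - η') 0 = 0 :=
    fracInt_apply_zero_of_eq_zero (by linarith) (sub_eq_zero.2 hx.init_one)
  have h0' : fracInt (1 - β) (fun s => x s - η) 0 = 0 :=
    fracInt_apply_zero_of_eq_zero (by linarith) (sub_eq_zero.2 hx.init_zero)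
  simp only [Pi.sub_apply, Function.comp_apply, h0, h0', map_zero, sub_zero] at h
  rw [h]
  abel

/-- Commuting `I^1` past `I^{2-α}` and `I^{1-β}` writes both sides of the integrated equation as
`I^1` of integral-form Caputo derivatives. -/
theorem IsClassicalSolution.volterra [CompleteSpace Y] {α β T : ℝ} (hα1 : 1 < α) (hα2 : α ≤ 2)
    (hβ0 : 0 < β) (hβ1 : β ≤ 1) (hT : 0 < T) {A B : Y →L[ℝ] Y} {g x : ℝ → Y} {η η' : Y}
    (hg : ContinuousOn g (Icc 0 T)) (hx : IsClassicalSolution α β T A B g η η' x) :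
    ∀ t ∈ Icc 0 T, x t - η = (t • η' + fracInt α (fun s => B η + g s) t)
      + A (fracInt (α - β) (fun s => x s - η) t) + B (fracInt α (fun s => x s - η) t) := by
  have hu := uniqueDiffOn_Icc hT
  have hxc := hx.contDiffOn.continuousOn
  have hx' : ContinuousOn (derivWithin x (Icc 0 T)) (Icc 0 T) :=
    hx.contDiffOn.continuousOn_derivWithin hu (by norm_num)
  have hx'' : ContinuousOn (iteratedDerivWithin 2 x (Icc 0 T)) (Icc 0 T) :=
    hx.contDiffOn.continuousOn_iteratedDerivWithin (by norm_num) hu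
  have hxx' : ∀ t ∈ Icc 0 T, fracInt 1 (derivWithin x (Icc 0 T)) t = x t - η := fun t ht => by
    rw [← hx.init_zero]
    exact fracInt_one_eq_sub hxc hx' (fun s hs =>
      (hx.contDiffOn.differentiableOn (by norm_num) s
        (Ioo_subset_Icc_self hs)).hasDerivWithinAt.hasDerivAt (Icc_mem_nhds hs.1 hs.2)) ht
  have hxx'' : ∀ t ∈ Icc 0 T, fracInt 1 (iteratedDerivWithin 2 x (Icc 0 T)) t
      = derivWithin x (Icc 0 T) t - η' := fun t ht => by
    rw [← hx.init_one]
    refine fracInt_one_eq_sub hx' hx'' (fun s hs => ?_) ht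
    have h1 : DifferentiableOn ℝ (iteratedDerivWithin 1 x (Icc 0 T)) (Icc 0 T) :=
      hx.contDiffOn.differentiableOn_iteratedDerivWithin (by norm_num) hu
    have h2 := (h1 s (Ioo_subset_Icc_self hs)).hasDerivWithinAt
    rw [← iteratedDerivWithin_succ, iteratedDerivWithin_one] at h2
    exact h2.hasDerivAt (Icc_mem_nhds hs.1 hs.2)
  refine volterra_of_integrated hα1 hα2 hβ1 A B hg hxc hx' hxx' fun t ht => ?_
  have hsub : Icc 0 t ⊆ Icc 0 T := Icc_subset_Icc_right ht.2
  have h1 : fracInt (2 - α) (fun s => derivWithin x (Icc 0 T) s - η') t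
      = fracInt 1 (fracInt (2 - α) (iteratedDerivWithin 2 x (Icc 0 T))) t := by
    rw [fracInt_comp (c := 3 - α) zero_le_one (by linarith) (by ring) hx'' ht,
      ← fracInt_comp (a := 2 - α) (b := 1) (by linarith) zero_le_one (by ring) hx'' ht]
    exact fracInt_congr ht.1 fun s hs => (hxx'' s (hsub hs)).symm
  have h2 : fracInt (1 - β) (fun s => x s - η) t
      = fracInt 1 (fracInt (1 - β) (derivWithin x (Icc 0 T))) t := by
    rw [fracInt_comp (c := 2 - β) zero_le_one (by linarith) (by ring) hx' ht,
      ← fracInt_comp (a := 1 - β) (b := 1) (by linarith) zero_le_one (by ring) hx' ht]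
    exact fracInt_congr ht.1 fun s hs => (hxx' s (hsub hs)).symm
  rw [h1, h2, ← fracInt_clm_add zero_le_one A (continuousOn_fracInt (by linarith) hx')
    (continuousOn_clm_apply_add B hxc hg) ht]
  -- The equation is given only for `s > 0`; the integral ignores the point `0`.
  refine fracInt_congr_Ioc one_pos ht.1 fun s hs => ?_
  have h := hx.equation s ⟨hs.1, hs.2.trans ht.2⟩
  simp only [caputoIntegral, natCeil_eq_two hα1 hα2, natCeil_eq_one hβ0 hβ1,
    iteratedDerivWithin_one, Nat.cast_one, Nat.cast_ofNat] at h
  rw [← h]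
  abel

/-- A continuously differentiable solution of the Volterra equation is a mild solution. -/
theorem isMildSolution_of_volterra [CompleteSpace Y] {α β T : ℝ} (hα1 : 1 < α) (hα2 : α ≤ 2)
    (hβ0 : 0 < β) (hβ1 : β ≤ 1) (hT : 0 < T) {A B : Y →L[ℝ] Y} {g x w : ℝ → Y} {η η' : Y}
    (hg : ContinuousOn g (Icc 0 T)) (hw : ContinuousOn w (Icc 0 T)) (hw0 : w 0 = η')
    (hxw : ∀ t ∈ Icc 0 T, x t = η + fracInt 1 w t)
    (h : ∀ t ∈ Icc 0 T, x t - η = (t • η' + fracInt α (fun s => B η + g s) t)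
      + A (fracInt (α - β) (fun s => x s - η) t) + B (fracInt α (fun s => x s - η) t)) :
    IsMildSolution α β T A B g η η' x := by
  have hu := uniqueDiffOn_Icc hT
  have huo := uniqueDiffOn_Ioc 0 T
  have hD : ∀ t ∈ Icc 0 T, HasDerivWithinAt x (w t) (Icc 0 T) t := fun t ht =>
    ((hasDerivWithinAt_fracInt_one hw ht).const_add η).congr hxw (hxw t ht)
  have hxc : ContinuousOn x (Icc 0 T) := fun t ht => (hD t ht).continuousWithinAt
  have hx0 : x 0 = η := by
    rw [hxw 0 ⟨le_rfl, hT.le⟩, fracInt_apply_zero one_pos, add_zero]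
  have hx1 : derivWithin x (Icc 0 T) 0 = η' := by
    rw [(hD 0 ⟨le_rfl, hT.le⟩).derivWithin (hu 0 ⟨le_rfl, hT.le⟩), hw0]
  have hz : ContinuousOn (fun s => x s - η) (Icc 0 T) := hxc.sub continuousOn_const
  have hBg : ContinuousOn (fun s => B η + g s) (Icc 0 T) := continuousOn_const.add hg
  have hBx : ContinuousOn (fun s => B (x s) + g s) (Icc 0 T) :=
    continuousOn_clm_apply_add B hxc hg
  have hzw : ∀ t ∈ Icc 0 T, x t - η = fracInt 1 w t := fun t ht => by
    rw [hxw t ht, add_sub_cancel_left]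
  have hwc := continuousOn_fracInt (γ := 1 - β) (by linarith) hw
  have hq : ContinuousOn (fun s => A (fracInt (1 - β) w s) + (B (x s) + g s)) (Icc 0 T) :=
    continuousOn_clm_apply_add A hwc hBx
  have hqc := continuousOn_fracInt zero_le_one hq
  have hy : ∀ t ∈ Icc 0 T, x t - (η + t • η') =
      A (fracInt (α - β + 1) w t) + fracInt α (fun s => B (x s) + g s) t := fun t ht => by
    have h1 : fracInt α (fun s => B (x s) + g s) t
        = B (fracInt α (fun s => x s - η) t) + fracInt α (fun s => B η + g s) t := by
      rw [← fracInt_clm_add (by linarith) B hz hBg ht]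
      refine fracInt_congr ht.1 fun s _ => ?_
      simp only [map_sub]
      abel
    have h2 : fracInt (α - β) (fun s => x s - η) t = fracInt (α - β + 1) w t := by
      rw [← fracInt_comp (by linarith) zero_le_one rfl hw ht]
      exact fracInt_congr ht.1 fun s hs => hzw s (Icc_subset_Icc_right ht.2 hs)
    rw [← sub_sub, h t ht, h1, h2]
    abel
  -- `I^{2-α}` raises the orders `α - β + 1` and `α` in `hy` to `3 - β` and `2`. Two integrations
  -- split off, leaving the continuous function `A I^{1-β} w + B x + g` as `D^α x`.
  have hU : ∀ t ∈ Icc 0 T, caputoPrimitive α T x t =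
      fracInt 1 (fracInt 1 fun s => A (fracInt (1 - β) w s) + (B (x s) + g s)) t :=
    fun t ht => by
    rw [caputoPrimitive_of_le_two hα1 hα2, hx0, hx1,
      fracInt_comp (c := 2) zero_le_one zero_le_one (by norm_num) hq ht,
      fracInt_clm_add zero_le_two A hwc hBx ht,
      fracInt_comp (c := 3 - β) zero_le_two (by linarith) (by ring) hw ht,
      fracInt_congr ht.1 fun s hs => hy s (Icc_subset_Icc_right ht.2 hs),
      fracInt_clm_add (by linarith) A (continuousOn_fracInt (by linarith) hw)
        (continuousOn_fracInt (by linarith) hBx) ht,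
      fracInt_comp (c := 3 - β) (by linarith) (by linarith) (by ring) hw ht,
      fracInt_comp (c := 2) (by linarith) (by linarith) (by ring) hBx ht]
  have hV : ∀ t ∈ Icc 0 T, caputoPrimitive β T x t = fracInt 1 (fracInt (1 - β) w) t :=
    fun t ht => by
    rw [caputoPrimitive_of_le_one hβ0 hβ1, hx0,
      fracInt_comp (c := 2 - β) zero_le_one (by linarith) (by ring) hw ht,
      ← fracInt_comp (a := 1 - β) (b := 1) (by linarith) zero_le_one (by ring) hw ht]
    exact fracInt_congr ht.1 fun s hs => hzw s (Icc_subset_Icc_right ht.2 hs)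
  have hU' : ∀ t ∈ Ioc 0 T, HasDerivWithinAt (caputoPrimitive α T x)
      (fracInt 1 (fun s => A (fracInt (1 - β) w s) + (B (x s) + g s)) t) (Ioc 0 T) t :=
    fun t ht => ((hasDerivWithinAt_fracInt_one hqc (Ioc_subset_Icc_self ht)).congr hU
      (hU t (Ioc_subset_Icc_self ht))).mono Ioc_subset_Icc_self
  have hU'' : ∀ t ∈ Ioc 0 T, HasDerivWithinAt
      (fracInt 1 fun s => A (fracInt (1 - β) w s) + (B (x s) + g s))
      (A (fracInt (1 - β) w t) + (B (x t) + g t)) (Ioc 0 T) t := fun t ht =>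
    (hasDerivWithinAt_fracInt_one hq (Ioc_subset_Icc_self ht)).mono Ioc_subset_Icc_self
  have hV' : ∀ t ∈ Ioc 0 T, HasDerivWithinAt (caputoPrimitive β T x)
      (fracInt (1 - β) w t) (Ioc 0 T) t :=
    fun t ht => ((hasDerivWithinAt_fracInt_one hwc (Ioc_subset_Icc_self ht)).congr hV
      (hV t (Ioc_subset_Icc_self ht))).mono Ioc_subset_Icc_self
  refine ⟨contDiffOn_one_of_hasDerivWithinAt hu hD hw, hx0, hx1, ?_, ?_, fun t ht => ?_⟩
  · rw [CaputoDifferentiable, natCeil_eq_two hα1 hα2]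
    exact contDiffOn_two_of_hasDerivWithinAt huo hU' hU'' (hq.mono Ioc_subset_Icc_self)
  · rw [CaputoDifferentiable, natCeil_eq_one hβ0 hβ1]
    exact contDiffOn_one_of_hasDerivWithinAt huo hV' (hwc.mono Ioc_subset_Icc_self)
  · rw [caputo, caputo, natCeil_eq_two hα1 hα2, natCeil_eq_one hβ0 hβ1, iteratedDerivWithin_one,
      (hV' t ht).derivWithin (huo t ht),
      iteratedDerivWithin_two_of_hasDerivWithinAt huo hU' ht (hU'' t ht), add_sub_cancel_left]

/-! ### Regularity of the resolvent and the explicit formula -/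

/-- `I^1` commutes with the Volterra operator and maps the second forcing term to the first, so both
sides solve one Volterra equation. This supplies the derivative of the solution without
differentiating a series. -/
theorem resolvent_eq_fracInt_one [CompleteSpace Y] {α β T : ℝ} (hα1 : 1 < α) (hβ1 : β ≤ 1)
    (A B : Y →L[ℝ] Y) {f : ℝ → Y} (hf : ContinuousOn f (Icc 0 T)) (v : Y) :
    EqOn (resolvent (α - β) α A B fun t => t • v + fracInt α f t)
      (fracInt 1 (resolvent (α - β) α A B fun t => v + fracInt (α - 1) f t)) (Icc 0 T) := by
  have ha : 0 < α - β := by linarith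
  have hb : 0 < α := by linarith
  have hF : ContinuousOn (fun t => t • v + fracInt α f t) (Icc 0 T) :=
    (continuousOn_id.smul continuousOn_const).add (continuousOn_fracInt hb.le hf)
  have hF1 : ContinuousOn (fracInt (α - 1) f) (Icc 0 T) := continuousOn_fracInt (by linarith) hf
  have hF' : ContinuousOn (fun t => v + fracInt (α - 1) f t) (Icc 0 T) :=
    continuousOn_const.add hF1
  have hw := continuousOn_resolvent ha hb A B hF'
  refine eqOn_of_volterra ha hb A B (continuousOn_resolvent ha hb A B hF)
    (continuousOn_fracInt zero_le_one hw) (fun t ht => resolvent_eq ha hb A B hF ht)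
    fun t ht => ?_
  have hsub : Icc 0 t ⊆ Icc 0 T := Icc_subset_Icc_right ht.2
  have hcomm : ∀ γ, 0 ≤ γ → ∀ w : ℝ → Y, ContinuousOn w (Icc 0 T) →
      fracInt 1 (fracInt γ w) t = fracInt γ (fracInt 1 w) t := fun γ hγ w hw => by
    rw [fracInt_comp zero_le_one hγ (add_comm _ _) hw ht, fracInt_comp hγ zero_le_one rfl hw ht]
  have hBw := continuousOn_fracInt hb.le hw
  rw [fracInt_congr ht.1 fun s hs => (resolvent_eq ha hb A B hF' (hsub hs)).trans
      ((add_assoc _ _ _).trans (add_comm _ _)),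
    fracInt_add zero_le_one ht.1
      ((continuousOn_clm_apply_add A (continuousOn_fracInt ha.le hw)
        (continuousOn_clm_apply B hBw)).mono hsub) (hF'.mono hsub),
    fracInt_clm_add (g := fun s => B (fracInt α _ s)) zero_le_one A
      (continuousOn_fracInt ha.le hw) (continuousOn_clm_apply B hBw) ht,
    fracInt_clm zero_le_one ht.1 (hBw.mono hsub), hcomm _ ha.le _ hw, hcomm _ hb.le _ hw,
    fracInt_add zero_le_one ht.1 continuousOn_const (hF1.mono hsub), fracInt_one_const,
    fracInt_comp (c := α) zero_le_one (by linarith) (by ring) hf ht]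
  abel

/-- The scalar `t^{ka+mb+c-1} / Γ(ka+mb+c)` is `I^{ka+mb+c-1} 1`; this turns the initial-data terms
of the formula into resolvent terms. -/
theorem rpow_smul_mlTerm_apply [CompleteSpace Y] {a b c t : ℝ} (ha : 0 ≤ a) (hb : 0 ≤ b)
    (hc : 1 ≤ c) (A B : Y →L[ℝ] Y) (ht : 0 ≤ t) (p : ℕ × ℕ) (v : Y) :
    t ^ (c - 1) • mlTerm a b c A B t p.1 p.2 v =
      Q A B p.1 p.2 (fracInt (termOrder a b p + (c - 1)) (fun _ => v) t) := by
  have ho := termOrder_nonneg ha hb p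
  have hc' : 0 ≤ c - 1 := by linarith
  rw [fracInt_const (by linarith), map_smul, mlTerm, smul_apply, smul_smul,
    Real.rpow_add_of_nonneg ht ho hc', add_assoc _ (c - 1), sub_add_cancel, termOrder]
  congr 1
  ring

/-- Each term of the kernel is `Q_{k,m}` times the kernel of `I^{ka+mb+b}`. As `b > 1`, the factor
`(t - s)^{b-1}` is bounded, and the constants `t^{b-1} ‖mlTerm(t)‖ M` justify summing under the
integral. -/
theorem hasSum_convolution [CompleteSpace Y] {a b t : ℝ} (ha : 0 < a) (hb : 1 < b)
    (A B : Y →L[ℝ] Y) {g : ℝ → Y} (ht : 0 ≤ t) (hg : ContinuousOn g (Icc 0 t)) :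
    HasSum (fun p : ℕ × ℕ => Q A B p.1 p.2 (fracInt (termOrder a b p + b) g t))
      (∫ s in (0 : ℝ)..t, (t - s) ^ (b - 1) • mittagLeffler a b b A B (t - s) (g s)) := by
  have hb0 : 0 < b := by linarith
  obtain ⟨M, hM⟩ := isCompact_Icc.exists_bound_of_continuousOn hg
  have hmem : ∀ s ∈ uIoc 0 t, s ∈ Icc 0 t := fun s hs => by
    rw [uIoc_of_le ht] at hs
    exact Ioc_subset_Icc_self hs
  have hterm : ∀ p : ℕ × ℕ, ∫ s in (0 : ℝ)..t,
      (t - s) ^ (b - 1) • mlTerm a b b A B (t - s) p.1 p.2 (g s)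
      = Q A B p.1 p.2 (fracInt (termOrder a b p + b) g t) := fun p => by
    have ho := termOrder_nonneg ha.le hb0.le p
    rw [← fracInt_clm (by linarith) ht hg, fracInt_of_pos (by linarith),
      ← intervalIntegral.integral_smul]
    refine intervalIntegral.integral_congr fun s hs => ?_
    rw [uIcc_of_le ht] at hs
    have hst : 0 ≤ t - s := by linarith [hs.2]
    simp only [mlTerm, smul_apply, smul_smul]
    rw [add_sub_assoc, Real.rpow_add_of_nonneg hst ho (by linarith), termOrder]
    congr 1
    ring
  have hcont : ∀ p : ℕ × ℕ, ContinuousOn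
      (fun s => (t - s) ^ (b - 1) • mlTerm a b b A B (t - s) p.1 p.2 (g s)) (Icc 0 t) :=
    fun p => by
    have h1 : Continuous fun s : ℝ => (t - s) ^ (b - 1) :=
      (Real.continuous_rpow_const (by linarith)).comp (by fun_prop)
    have h2 : ContinuousOn (fun s => mlTerm a b b A B (t - s) p.1 p.2) (Icc 0 t) :=
      (continuousOn_mlTerm ha.le hb0.le A B p univ).comp (by fun_prop) (fun _ _ => mem_univ _)
    exact h1.continuousOn.smul (h2.clm_apply hg)
  have hsum := intervalIntegral.hasSum_integral_of_dominated_convergence (μ := volume)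
    (a := 0) (b := t)
    (F := fun (p : ℕ × ℕ) s => (t - s) ^ (b - 1) • mlTerm a b b A B (t - s) p.1 p.2 (g s))
    (f := fun s => (t - s) ^ (b - 1) • mittagLeffler a b b A B (t - s) (g s))
    (fun p _ => t ^ (b - 1) * (‖mlTerm a b b A B t p.1 p.2‖ * M)) (fun p => ?_) (fun p => ?_)
    (.of_forall fun _ _ => ((summable_norm_mlTerm ha hb0 hb.le A B ht).mul_right M).mul_left _)
    intervalIntegrable_const (.of_forall fun s hs => ?_)
  · simpa only [hterm] using hsum
  · refine ((hcont p).mono hmem).aestronglyMeasurable measurableSet_uIoc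
  · refine .of_forall fun s hs => ?_
    have hs' := hmem s hs
    have hst : 0 ≤ t - s := by linarith [hs'.2]
    have hM0 : 0 ≤ M := (norm_nonneg _).trans (hM s hs')
    rw [norm_smul, Real.norm_of_nonneg (Real.rpow_nonneg hst _)]
    refine mul_le_mul (Real.rpow_le_rpow hst (by linarith [hs'.1]) (by linarith)) ?_
      (norm_nonneg _) (Real.rpow_nonneg ht _)
    refine (ContinuousLinearMap.le_opNorm _ _).trans (mul_le_mul ?_ (hM s hs') (norm_nonneg _)
      (norm_nonneg _))
    exact norm_mlTerm_le ha.le hb0.le hb0 A B hst (by linarith [hs'.1]) p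
  · have hst : 0 ≤ t - s := by linarith [(hmem s hs).2]
    exact (hasSum_mittagLeffler_apply ha hb0 hb.le A B hst (g s)).const_smul _

/-- The explicit formula is given by the resolvent of the Volterra operator. -/
theorem solutionFormula_eq [CompleteSpace Y] {α β T t : ℝ} (hα1 : 1 < α) (hβ1 : β ≤ 1)
    (A B : Y →L[ℝ] Y) {g : ℝ → Y} (hg : ContinuousOn g (Icc 0 T)) (η η' : Y)
    (ht : t ∈ Icc 0 T) :
    solutionFormula α β A B g η η' t =
      η + resolvent (α - β) α A B (fun s => s • η' + fracInt α (fun r => B η + g r) s) t := by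
  have ha : 0 < α - β := by linarith
  have hb : 0 < α := by linarith
  have hsub : Icc 0 t ⊆ Icc 0 T := Icc_subset_Icc_right ht.2
  have hBg : ContinuousOn (fun s => B η + g s) (Icc 0 T) := continuousOn_const.add hg
  have hBgα := continuousOn_fracInt hb.le hBg
  have hid : ContinuousOn (fun s : ℝ => s • η') (Icc 0 T) :=
    continuousOn_id.smul continuousOn_const
  have h1 := (hasSum_mittagLeffler_apply (c := α + 1) ha hb (by linarith) A B ht.1
    (B η)).const_smul (t ^ (α + 1 - 1))
  have h2 := (hasSum_mittagLeffler_apply (c := 2) ha hb one_le_two A B ht.1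
    η').const_smul (t ^ ((2 : ℝ) - 1))
  have h3 := hasSum_convolution ha hα1 A B ht.1 (hg.mono hsub)
  have h4 := hasSum_resolvent ha hb A B (hid.add hBgα) ht
  have h5 := h4.unique (((h1.add h2).add h3).congr_fun fun p => ?_)
  · rw [solutionFormula, add_apply, smul_apply,
      mul_apply_eq_comp, one_apply_eq_self]
    rw [add_sub_cancel_right, show (2 : ℝ) - 1 = 1 by norm_num, Real.rpow_one] at h5
    rw [add_assoc, add_assoc, ← add_assoc (t ^ α • _)]
    exact congrArg (η + ·) h5.symm
  · have ho := termOrder_nonneg ha.le hb.le p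
    rw [rpow_smul_mlTerm_apply ha.le hb.le (by linarith) A B ht.1,
      rpow_smul_mlTerm_apply ha.le hb.le one_le_two A B ht.1, ← map_add, ← map_add,
      add_sub_cancel_right, show (2 : ℝ) - 1 = 1 by norm_num]
    congr 1
    -- Since `s η' = I^1 η'`, the semigroup law raises the order by one.
    have h6 : fracInt (termOrder (α - β) α p) (fun s => s • η') t
        = fracInt (termOrder (α - β) α p + 1) (fun _ => η') t := by
      rw [← fracInt_comp ho zero_le_one rfl continuousOn_const ht]
      exact fracInt_congr ht.1 fun s _ => (fracInt_one_const η' s).symm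
    refine (fracInt_add ho ht.1 (hid.mono hsub) (hBgα.mono hsub)).trans ?_
    rw [h6, fracInt_comp ho hb.le rfl hBg ht,
      fracInt_add (by linarith) ht.1 continuousOn_const (hg.mono hsub)]
    abel

theorem eqOn_solutionFormula_of_volterra [CompleteSpace Y] {α β T : ℝ} (hα1 : 1 < α)
    (hβ1 : β ≤ 1) (A B : Y →L[ℝ] Y) {g x : ℝ → Y} {η η' : Y}
    (hg : ContinuousOn g (Icc 0 T)) (hx : ContinuousOn x (Icc 0 T))
    (h : ∀ t ∈ Icc 0 T, x t - η = (t • η' + fracInt α (fun s => B η + g s) t)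
      + A (fracInt (α - β) (fun s => x s - η) t) + B (fracInt α (fun s => x s - η) t)) :
    EqOn x (solutionFormula α β A B g η η') (Icc 0 T) := by
  have ha : 0 < α - β := by linarith
  have hb : 0 < α := by linarith
  have hF : ContinuousOn (fun s => s • η' + fracInt α (fun r => B η + g r) s) (Icc 0 T) :=
    (continuousOn_id.smul continuousOn_const).add
      (continuousOn_fracInt hb.le (continuousOn_const.add hg))
  intro t ht
  rw [solutionFormula_eq hα1 hβ1 A B hg η η' ht, ← sub_eq_iff_eq_add']
  exact eqOn_of_volterra ha hb A B (hx.sub continuousOn_const) (continuousOn_resolvent ha hb A B hF)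
    h (fun s hs => resolvent_eq ha hb A B hF hs) ht

theorem isMildSolution_solutionFormula [CompleteSpace Y] {α β T : ℝ} (hα1 : 1 < α)
    (hα2 : α ≤ 2) (hβ0 : 0 < β) (hβ1 : β ≤ 1) (hT : 0 < T) (A B : Y →L[ℝ] Y) {g : ℝ → Y}
    (hg : ContinuousOn g (Icc 0 T)) (η η' : Y) :
    IsMildSolution α β T A B g η η' (solutionFormula α β A B g η η') := by
  have ha : 0 < α - β := by linarith
  have hb : 0 < α := by linarith
  have hBg : ContinuousOn (fun s => B η + g s) (Icc 0 T) := continuousOn_const.add hg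
  have hF : ContinuousOn (fun s => s • η' + fracInt α (fun r => B η + g r) s) (Icc 0 T) :=
    (continuousOn_id.smul continuousOn_const).add (continuousOn_fracInt hb.le hBg)
  have hF' : ContinuousOn (fun s => η' + fracInt (α - 1) (fun r => B η + g r) s) (Icc 0 T) :=
    continuousOn_const.add (continuousOn_fracInt (by linarith) hBg)
  have hz : EqOn (fun s => solutionFormula α β A B g η η' s - η)
      (resolvent (α - β) α A B fun s => s • η' + fracInt α (fun r => B η + g r) s)
      (Icc 0 T) := fun t ht => by
    simp only [solutionFormula_eq hα1 hβ1 A B hg η η' ht, add_sub_cancel_left]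
  refine isMildSolution_of_volterra (w := resolvent (α - β) α A B
    fun s => η' + fracInt (α - 1) (fun r => B η + g r) s) hα1 hα2 hβ0 hβ1 hT hg
    (continuousOn_resolvent ha hb A B hF') ?_ (fun t ht => ?_) fun t ht => ?_
  -- At `t = 0` all three fractional integrals vanish, `I^{α-1}` because `α > 1`, and only `η'`
  -- survives.
  · rw [resolvent_eq ha hb A B hF' ⟨le_rfl, hT.le⟩, fracInt_apply_zero ha, fracInt_apply_zero hb,
      fracInt_apply_zero (by linarith)]
    simp
  · rw [solutionFormula_eq hα1 hβ1 A B hg η η' ht,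
      resolvent_eq_fracInt_one hα1 hβ1 A B hBg η' ht]
  · rw [fracInt_eqOn hz ht, fracInt_eqOn hz ht]
    exact (hz ht).trans (resolvent_eq ha hb A B hF ht)

end FracEvol

end

theorem mainTheorem1 {Y : Type*} [NormedAddCommGroup Y] [NormedSpace ℝ Y] [CompleteSpace Y]
    (α β T : ℝ) (hα1 : 1 < α) (hα2 : α ≤ 2) (hβ0 : 0 < β) (hβ1 : β ≤ 1) (hT : 0 < T)
    (A B : Y →L[ℝ] Y) (g : ℝ → Y) (hg : ContinuousOn g (Set.Icc 0 T)) (η η' : Y) :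
    -- the double series in the formula converge absolutely
    (∀ c ∈ ({α + 1, 2, α} : Set ℝ), ∀ t : ℝ, 0 ≤ t →
      Summable (fun p : ℕ × ℕ => ‖FracEvol.mlTerm (α - β) α c A B t p.1 p.2‖)) ∧
    -- the integral in the formula converges
    (∀ t ∈ Set.Icc 0 T, IntervalIntegrable
      (fun s => (t - s) ^ (α - 1) • FracEvol.mittagLeffler (α - β) α α A B (t - s) (g s))
      MeasureTheory.volume 0 t) ∧
    -- the formula is a solution
    FracEvol.IsMildSolution α β T A B g η η' (FracEvol.solutionFormula α β A B g η η') ∧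
    -- every solution is given by the formula
    (∀ x : ℝ → Y, FracEvol.IsMildSolution α β T A B g η η' x →
      Set.EqOn x (FracEvol.solutionFormula α β A B g η η') (Set.Icc 0 T)) ∧
    -- in particular every twice continuously differentiable solution
    (∀ x : ℝ → Y, FracEvol.IsClassicalSolution α β T A B g η η' x →
      Set.EqOn x (FracEvol.solutionFormula α β A B g η η') (Set.Icc 0 T)) := by
  have ha : 0 < α - β := by linarith
  have hb : 0 < α := by linarith
  refine ⟨fun c hc t ht => ?_, fun t ht => ?_,
    FracEvol.isMildSolution_solutionFormula hα1 hα2 hβ0 hβ1 hT A B hg η η', fun x hx => ?_,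
    fun x hx => ?_⟩
  · refine FracEvol.summable_norm_mlTerm ha hb ?_ A B ht
    simp only [Set.mem_insert_iff, Set.mem_singleton_iff] at hc
    rcases hc with rfl | rfl | rfl <;> linarith
  · refine ContinuousOn.intervalIntegrable ?_
    rw [Set.uIcc_of_le ht.1]
    exact FracEvol.continuousOn_convolution_integrand ha hα1 A B ht.1
      (hg.mono (Set.Icc_subset_Icc_right ht.2))
  · exact FracEvol.eqOn_solutionFormula_of_volterra hα1 hβ1 A B hg hx.contDiffOn.continuousOn
      (hx.volterra hα1 hα2 hβ0 hβ1 hT hg)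
  · exact FracEvol.eqOn_solutionFormula_of_volterra hα1 hβ1 A B hg hx.contDiffOn.continuousOn
      (hx.volterra hα1 hα2 hβ0 hβ1 hT hg)
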